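/- Let $G=(V,E)$ be a finite simple graph with $m$ edges, adjacency matrix $A=(a_{uv})$ and degrees $k_v$. Let $Q$ be the set of unordered pairs $\{st,uv\}$ of edges of $G$ without common vertices, $q=|Q|$, and let $n_G(F)$ be the number of (not necessarily induced) subgraphs of $G$ isomorphic to $F$. $L_r$ and $C_r$ are the path and the cycle on $r$ vertices, $\mathrm{paw}$ is a triangle with a pendant edge, $\oplus$ is disjoint union. Put $$K=\sum_{\{st,uv\}\in Q}(k_s+k_t+k_u+k_v),\quad \Phi_1=\sum_{Q}(k_sk_t+k_uk_v),\quad \Phi_2=\sum_{Q}(k_s+k_t)(k_u+k_v),$$ $$\Lambda_1=\sum_{Q}\bigl(k_s(a_{tu}+a_{tv})+k_t(a_{su}+a_{sv})+k_u(a_{sv}+a_{tv})+k_v(a_{su}+a_{tu})\bigr),\quad \Lambda_2=\sum_{Q}(a_{su}+a_{sv}+a_{tu}+a_{tv})(k_s+k_t+k_u+k_v).$$ The type of $(p,p')\in Q\times Q$ is the code $\tau\phi$, where $\tau$ is the number of common edges and $\phi$ the number of common vertices of $p$ and $p'$; code $02$ is split into $021$ (the two common vertices are joined by an edge of $p$ or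 of $p'$, as in $(\{st,uv\},\{su,wx\})$) and $022$ (otherwise, as in $(\{st,uv\},\{sw,ux\})$). So the types are $00,01,021,022,03,04,12,13,24$. Let $f_\omega$ be the number of elements of $Q\times Q$ of type $\omega$. (1) In every graph, $f_{24}=q$; $f_{13}=K-4q-2n_G(L_4)$; $f_{12}=2[(m+2)q+n_G(L_4)-K]$; $f_{04}=2n_G(C_4)=\tfrac14\mathrm{tr}(A^4)-n_G(L_3)-\tfrac12n_G(L_2)=\tfrac14\mathrm{tr}(A^4)+q-\tfrac12m^2$; $f_{03}=\Lambda_1-2n_G(L_4)-8n_G(C_4)-2n_G(\mathrm{paw})$; $f_{021}=2q+(m+5)n_G(L_4)+8n_G(C_4)+3n_G(\mathrm{paw})+\Phi_1-3n_G(C_3\oplus L_2)-\Lambda_1-\Lambda_2-K$; $f_{022}=4q+5n_G(L_4)+2n_G(\mathrm{paw})+4n_G(C_4)+\Phi_2-\Lambda_2-2K-n_G(L_5)$. If $G$ is a forest, $n_G(C_4)=n_G(\mathrm{paw})=n_G(C_3\oplus L_2)=0$. (2) A random layout consists of a random arrangement $\pi:V\to S$ of the vertices in a space $S$ and of the number of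 crossings between any two edges drawn between given positions. Suppose that almost surely no edge crosses itself, two edges cross at most once and edges that share a vertex do not cross, and that the number $C$ of crossings of $G$ counts crossings per pair of edges (so $e$ edges crossing at one point incur $\binom e2$ crossings). Let $\alpha(p)$ be the indicator that the two edges of $p$ cross, and suppose that the layout has constants $\delta$ and $E_\omega$, i.e. that for independent pairs of possible edges (pairs of distinct vertices) $\mathbb E[\alpha(p)]=\delta$ always and $\mathbb E[(\alpha(p)-\delta)(\alpha(p')-\delta)]=E_\omega$ whenever $(p,p')$ has type $\omega$. Then $\mathbb V[C]=X(G)+f_{00}E_{00}+f_{01}E_{01}$, where $$\begin{aligned}X(G)={}&q\,(E_{24}-4E_{13}+2(m+2)E_{12}+2E_{021}+4E_{022})+K(E_{13}-2E_{12}-E_{021}-2E_{022})\\&+n_G(L_4)(-2E_{13}+2E_{12}-2E_{03}+(m+5)E_{021}+5E_{022})+n_G(C_4)(2E_{04}-8E_{03}+8E_{021}+4E_{022})\\&+n_G(\mathrm{paw})(-2E_{03}+3E_{021}+2E_{022})+\Lambda_1(E_{03}-E_{021})-\Lambda_2(E_{021}+E_{022})\\&-n_G(L_5)E_{022}-3n_G(C_3\oplus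 L_2)E_{021}+\Phi_1E_{021}+\Phi_2E_{022}.\end{aligned}$$ In particular, if $E_{00}=E_{01}=0$, then $\mathbb V[C]=X(G)$, and if moreover $G$ is a forest, the terms with $n_G(C_4)$, $n_G(\mathrm{paw})$ and $n_G(C_3\oplus L_2)$ can be omitted. Such constants exist whenever the law of $\pi$ is invariant under permutations of $V$; they can be chosen with $E_{00}=E_{01}=0$ whenever the vertices are placed independently with a common law $\nu$ on $S$ and any point of $S$ can be moved to any other one by a map of $S$ that preserves $\nu$ and the numbers of crossings (as for uniformly random points on a sphere joined by geodesics). (3) The uniformly random linear arrangement (a uniformly random bijection $V\to\{1,\dots,n\}$, where two edges cross, once, if and only if their endpoints interleave) satisfies the crossing properties, with $\delta=1/3$ and $E_{00}=E_{01}=0$, $E_{24}=\frac29$, $E_{13}=\frac1{18}$, $E_{12}=\frac1{45}$, $E_{04}=-\frac19$, $E_{03}=-\frac1{36}$, $E_{021}=-\frac1{90}$, $E_{022}=\frac1{180}$, and $$\begin{aligned}\mathbb V[C]=\tfrac1{180}\bigl[&8(m+2)q+2K-(2m+7)n_G(L_4)-12n_G(C_4)+6n_G(\mathrm{paw})\\&-n_G(L_5)+6n_G(C_3\oplus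 L_2)-3\Lambda_1+\Lambda_2-2\Phi_1+\Phi_2\bigr].\end{aligned}$$ If $G$ is a forest, $$\mathbb V[C]=\tfrac1{180}\bigl[8(m+2)q+2K-(2m+7)n_G(L_4)-n_G(L_5)-3\Lambda_1+\Lambda_2-2\Phi_1+\Phi_2\bigr].$$ -/

import Mathlib

open MeasureTheory ProbabilityTheory

namespace EdgeCrossing

/-- The types of ordered pairs of elements of `Q`. -/
inductive PairType
  | t00 | t24 | t13 | t12 | t04 | t03 | t021 | t022 | t01
  deriving DecidableEq

instance : Fintype PairType where
  elems := {.t00, .t24, .t13, .t12, .t04, .t03, .t021, .t022, .t01}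
  complete x := by cases x <;> simp

noncomputable section

section Graph

variable {V : Type*} [DecidableEq V]

/-- The set of vertices covered by a set of edges. -/
def vertices (p : Finset (Sym2 V)) : Finset V := p.biUnion Sym2.toFinset

/-- The type of `(p, q)`, where `p` and `q` are pairs of independent edges. The first digit is the
number of common edges, the second digit the number of common vertices. When there are no common
edges and two common vertices, the subtype is `1` if the two common vertices are joined by one of
the edges of `p` or of `q`, as in `({st, uv}, {su, wx})`, and `2` otherwise,
as in `({st, uv}, {sw, ux})`. The other combinations of digits do not occur. -/
def typeOf (p q : Finset (Sym2 V)) : PairType :=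
  match (p ∩ q).card, (vertices p ∩ vertices q).card with
  | 0, 0 => .t00
  | 0, 1 => .t01
  | 0, 2 => if ∃ e ∈ p ∪ q, e.toFinset = vertices p ∩ vertices q then .t021 else .t022
  | 0, 3 => .t03
  | 0, 4 => .t04
  | 1, 2 => .t12
  | 1, 3 => .t13
  | _, _ => .t24

variable [Fintype V] (G : SimpleGraph V) [DecidableRel G.Adj]

/-- `Q`: the set of unordered pairs of independent edges, i.e. edges without common vertices. -/
def indepPairs : Finset (Finset (Sym2 V)) :=
  {p ∈ G.edgeFinset.powersetCard 2 | ∀ e ∈ p, ∀ f ∈ p, e ≠ f → Disjoint e.toFinset f.toFinset}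

/-- `f_ω`: the number of elements of `Q × Q` of type `ω`. -/
def freq (ω : PairType) : ℝ :=
  ((indepPairs G ×ˢ indepPairs G).filter fun x => typeOf x.1 x.2 = ω).card

/-- The sum over `{st, uv} ∈ Q` of `F s t u v`. Every element of `Q` can be written as `{st, uv}`
in exactly eight ways, over which the value of `F` is averaged; below, `F` always takes the same
value on all of them. -/
def sumQ (F : V → V → V → V → ℝ) : ℝ :=
  ∑ p ∈ indepPairs G, (1 / 8) * ∑ s, ∑ t, ∑ u, ∑ v,
    if p = {s(s, t), s(u, v)} then F s t u v else 0

/-- The number of edges. -/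
def m : ℝ := G.edgeFinset.card

/-- The number of pairs of independent edges. -/
def q : ℝ := (indepPairs G).card

/-- The degree of a vertex. -/
def k (v : V) : ℝ := G.degree v

/-- The entries of the adjacency matrix. -/
def a (u v : V) : ℝ := G.adjMatrix ℝ u v

def K : ℝ := sumQ G fun s t u v => k G s + k G t + k G u + k G v

def Phi1 : ℝ := sumQ G fun s t u v => k G s * k G t + k G u * k G v

def Phi2 : ℝ := sumQ G fun s t u v => (k G s + k G t) * (k G u + k G v)

def Lambda1 : ℝ := sumQ G fun s t u v =>
  k G s * (a G t u + a G t v) + k G t * (a G s u + a G s v)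
    + k G u * (a G s v + a G t v) + k G v * (a G s u + a G t u)

def Lambda2 : ℝ := sumQ G fun s t u v =>
  (a G s u + a G s v + a G t u + a G t v) * (k G s + k G t + k G u + k G v)

end Graph

section SubgraphCounts

variable {V : Type*} [Fintype V] (G : SimpleGraph V)

/-- The paw: a triangle with a pendant edge. -/
def pawGraph : SimpleGraph (Fin 4) :=
  SimpleGraph.fromEdgeSet {s(0, 1), s(1, 2), s(0, 2), s(2, 3)}

/-- The number of subgraphs of `G` (not necessarily induced) isomorphic to the path on `r`
vertices. -/
def nL (r : ℕ) : ℝ := G.copyCount (SimpleGraph.pathGraph r)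

/-- The number of subgraphs of `G` isomorphic to the cycle on four vertices. -/
def nC4 : ℝ := G.copyCount (SimpleGraph.cycleGraph 4)

/-- The number of subgraphs of `G` isomorphic to the paw. -/
def nPaw : ℝ := G.copyCount pawGraph

/-- The number of subgraphs of `G` isomorphic to the disjoint union of a triangle and an edge. -/
def nC3L2 : ℝ := G.copyCount (SimpleGraph.cycleGraph 3 ⊕g SimpleGraph.pathGraph 2)

end SubgraphCounts

section Formulas

variable {V : Type*} [Fintype V] [DecidableEq V] (G : SimpleGraph V) [DecidableRel G.Adj]

open PairType

/-- The arithmetic expression for the variance of the number of crossings in a general graph. -/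
def varianceExpr (E : PairType → ℝ) : ℝ :=
  q G * (E t24 - 4 * E t13 + 2 * (m G + 2) * E t12 + 2 * E t021 + 4 * E t022)
    + K G * (E t13 - 2 * E t12 - E t021 - 2 * E t022)
    + nL G 4 * (-2 * E t13 + 2 * E t12 - 2 * E t03 + (m G + 5) * E t021 + 5 * E t022)
    + nC4 G * (2 * E t04 - 8 * E t03 + 8 * E t021 + 4 * E t022)
    + nPaw G * (-2 * E t03 + 3 * E t021 + 2 * E t022)
    + Lambda1 G * (E t03 - E t021)
    - Lambda2 G * (E t021 + E t022)
    - nL G 5 * E t022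
    - 3 * nC3L2 G * E t021
    + Phi1 G * E t021
    + Phi2 G * E t022

/-- The arithmetic expression for the variance of the number of crossings in a forest. -/
def varianceExprForest (E : PairType → ℝ) : ℝ :=
  q G * (E t24 - 4 * E t13 + 2 * (m G + 2) * E t12 + 2 * E t021 + 4 * E t022)
    + K G * (E t13 - 2 * E t12 - E t021 - 2 * E t022)
    + nL G 4 * (-2 * E t13 + 2 * E t12 - 2 * E t03 + (m G + 5) * E t021 + 5 * E t022)
    + Lambda1 G * (E t03 - E t021)
    - Lambda2 G * (E t021 + E t022)
    - nL G 5 * E t022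
    + Phi1 G * E t021
    + Phi2 G * E t022

end Formulas

section Layout

/-- A random layout of the vertex set `V` in the space `S`: the law of the random arrangement
`π : V → S`, and, for any two edges drawn between given (unordered) pairs of positions, the number
of times that they cross. -/
structure RandomLayout (V S : Type*) [MeasurableSpace S] where
  law : Measure (V → S)
  isProbabilityMeasure : IsProbabilityMeasure law
  crossings : Sym2 S → Sym2 S → ℕ
  crossings_comm : ∀ a b, crossings a b = crossings b a
  measurable_crossings :
    ∀ e f : Sym2 V, Measurable fun π : V → S => crossings (e.map π) (f.map π)

namespace RandomLayout

variable {V S : Type*} [MeasurableSpace S] (L : RandomLayout V S)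

/-- The number of crossings of the edges `e` and `f` in the arrangement `π`. -/
def cr (π : V → S) (e f : Sym2 V) : ℕ := L.crossings (e.map π) (f.map π)

/-- The first three crossing properties, required of almost every arrangement and of all the
possible edges (unordered pairs of distinct vertices): no edge crosses itself, two edges cross at
most once, and two distinct edges that share a vertex do not cross. -/
structure IsGood : Prop where
  no_self : ∀ᵐ π ∂L.law, ∀ e : Sym2 V, ¬ e.IsDiag → L.cr π e e = 0
  once : ∀ᵐ π ∂L.law, ∀ e f : Sym2 V, ¬ e.IsDiag → ¬ f.IsDiag → L.cr π e f ≤ 1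
  incident : ∀ᵐ π ∂L.law, ∀ e f : Sym2 V, ¬ e.IsDiag → ¬ f.IsDiag → e ≠ f →
    (∃ v, v ∈ e ∧ v ∈ f) → L.cr π e f = 0

/-- The number of crossings of a drawing of `G`: the sum over all the unordered pairs of edges
(an edge may be paired with itself) of the number of times that they cross. Crossings are counted
per pair of edges, so `r` edges that cross at one point contribute `r.choose 2`, which is the fourth
crossing property. -/
def C [Fintype V] [DecidableEq V] (G : SimpleGraph V) [DecidableRel G.Adj] (π : V → S) : ℕ :=
  ∑ z ∈ G.edgeFinset.sym2,
    Sym2.lift ⟨fun e f => L.cr π e f, fun _ _ => L.crossings_comm _ _⟩ z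

variable [DecidableEq V]

/-- `α(e₁, e₂)` for `p = {e₁, e₂}`: the indicator that the two edges of `p` cross. -/
def α (p : Finset (Sym2 V)) (π : V → S) : ℝ :=
  if ∃ e ∈ p, ∃ f ∈ p, e ≠ f ∧ L.cr π e f ≠ 0 then 1 else 0

/-- `δ` and `E ω` are the constants of the layout: `δ` is the probability that two independent
edges cross, and `E ω` is the expectation of `β(e₁, e₂) β(e₃, e₄)`, where `β = α - δ`, for
`({e₁, e₂}, {e₃, e₄})` of type `ω`. -/
structure HasConstants [Fintype V] (δ : ℝ) (E : PairType → ℝ) : Prop where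
  prob_eq : ∀ p ∈ indepPairs (⊤ : SimpleGraph V), ∫ π, L.α p π ∂L.law = δ
  expect_eq : ∀ p ∈ indepPairs (⊤ : SimpleGraph V), ∀ r ∈ indepPairs (⊤ : SimpleGraph V),
    ∫ π, (L.α p π - δ) * (L.α r π - δ) ∂L.law = E (typeOf p r)

/-- The law of the arrangement is invariant under permutations of the vertices. -/
def IsExchangeable : Prop :=
  ∀ σ : Equiv.Perm V, L.law.map (fun π => π ∘ σ) = L.law

/-- The vertices are placed independently according to a common law `ν` on `S`, and `S` looks the
same from each of its points: any point can be moved to any other one by a map that preserves `ν`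
and the crossings. An example is the uniform distribution on the sphere, with edges drawn as
geodesics. -/
def IsHomogeneous [Fintype V] : Prop :=
  ∃ ν : Measure S, IsProbabilityMeasure ν ∧ L.law = Measure.pi (fun _ => ν) ∧
    ∀ x y : S, ∃ g : S → S, MeasurePreserving g ν ν ∧ g x = y ∧
      ∀ a b : Sym2 S, L.crossings (a.map g) (b.map g) = L.crossings a b

end RandomLayout

section Linear

variable (V : Type*) [Fintype V]

/-- The linear arrangements of `V`: the bijections from `V` to the positions `0, …, n - 1`. -/
def linearArrangements : Set (V → Fin (Fintype.card V)) := {π | Function.Bijective π}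

theorem linearArrangements_nonempty : (linearArrangements V).Nonempty :=
  ⟨Fintype.equivFin V, (Fintype.equivFin V).bijective⟩

/-- Two edges drawn as arcs above the line cross once if their endpoints interleave, and do not
cross otherwise. -/
def arcCrossings {n : ℕ} (a b : Sym2 (Fin n)) : ℕ :=
  if (a.inf < b.inf ∧ b.inf < a.sup ∧ a.sup < b.sup) ∨
    (b.inf < a.inf ∧ a.inf < b.sup ∧ b.sup < a.sup) then 1 else 0

/-- The uniformly random linear arrangement. -/
def rla : RandomLayout V (Fin (Fintype.card V)) where
  law := uniformOn (linearArrangements V)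
  isProbabilityMeasure :=
    isProbabilityMeasure_uniformOn (Set.toFinite _) (linearArrangements_nonempty V)
  crossings := arcCrossings
  crossings_comm a b := by simp only [arcCrossings, or_comm]
  measurable_crossings _ _ := Measurable.of_discrete

/-- The values of `E ω` in uniformly random linear arrangements. -/
def rlaConstants : PairType → ℝ
  | .t00 => 0
  | .t24 => 2 / 9
  | .t13 => 1 / 18
  | .t12 => 1 / 45
  | .t04 => -1 / 9
  | .t03 => -1 / 36
  | .t021 => -1 / 90
  | .t022 => 1 / 180
  | .t01 => 0

end Linear

end Layout

end

end EdgeCrossing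

open EdgeCrossing EdgeCrossing.PairType

/-!
Since `C` is the sum of the indicators `α p` over `p ∈ Q`, all of mean `δ`, its variance is
`∑ ω, f_ω E_ω`.

A multiple of each frequency `f_ω` counts the embeddings of one pattern graph into `G`, because two
elements of `Q × Q` of the same type are images of one standard example. The degree of `G` at a
vertex of an embedded graph counts the ways to attach one more edge there, whose other end is either
another vertex of the embedded graph or a new one. Expanding the degrees in `K`, `Φ₁`, `Φ₂`, `Λ₁`
and `Λ₂` in this way expresses them through numbers of embeddings, and the formulas for `f_ω` are
linear combinations of these expansions.

The standard examples also give the constants `E_ω` of an exchangeable layout, since any two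
embeddings differ by a permutation of the vertices. For independent positions in a homogeneous
space, conditioning on the position of the only vertex that `p` and `p'` may share makes `α p` and
`α p'` independent, and by homogeneity the conditional crossing probability does not depend on this
position.

For the linear arrangement, exactly one of the three perfect matchings of four vertices crosses.
Hence `δ = 1 / 3`, and three constants sum to zero whenever the first pair of edges runs over the
three matchings. These relations determine all constants from `E_13` and `E_12`, which come from
counting the orderings of five and of six vertices.
-/

namespace EdgeCrossing

section Pairs

variable {V W U : Type*} [DecidableEq V]

/-- The image of a set of edges under a map of the vertices. -/
def mapEdges (f : W → V) (p : Finset (Sym2 W)) : Finset (Sym2 V) := p.image (Sym2.map f)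

theorem mapEdges_pair [DecidableEq W] (f : W → V) (s t u v : W) :
    mapEdges f {s(s, t), s(u, v)} = {s(f s, f t), s(f u, f v)} := by
  simp [mapEdges, Finset.image_insert]

theorem mapEdges_mapEdges [DecidableEq W] (g : W → V) (f : U → W) (p : Finset (Sym2 U)) :
    mapEdges g (mapEdges f p) = mapEdges (g ∘ f) p := by
  simp [mapEdges, Finset.image_image, Sym2.map_comp]

theorem mapEdges_injective {f : W → V} (hf : Function.Injective f) :
    Function.Injective (mapEdges f) :=
  Finset.image_injective (Sym2.map.injective hf)

theorem toFinset_map [DecidableEq W] (f : W → V) (e : Sym2 W) :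
    (e.map f).toFinset = e.toFinset.image f := by
  ext v; simp [Sym2.mem_map]

theorem vertices_mapEdges [DecidableEq W] (f : W → V) (p : Finset (Sym2 W)) :
    vertices (mapEdges f p) = (vertices p).image f := by
  simp only [vertices, mapEdges, Finset.image_biUnion, Finset.biUnion_image, toFinset_map]

theorem vertices_pair (s t u v : V) : vertices {s(s, t), s(u, v)} = {s, t, u, v} := by
  ext x; simp [vertices, or_assoc]

theorem typeOf_comm (p r : Finset (Sym2 V)) : typeOf p r = typeOf r p := by
  unfold typeOf
  rw [Finset.inter_comm p r, Finset.inter_comm (vertices p), Finset.union_comm p r]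

theorem typeOf_mapEdges [DecidableEq W] {f : W → V} (hf : Function.Injective f)
    (p r : Finset (Sym2 W)) :
    typeOf (mapEdges f p) (mapEdges f r) = typeOf p r := by
  have hedges : (mapEdges f p ∩ mapEdges f r).card = (p ∩ r).card := by
    rw [mapEdges, mapEdges, ← Finset.image_inter _ _ (Sym2.map.injective hf),
      Finset.card_image_of_injective _ (Sym2.map.injective hf)]
  have hvertices : vertices (mapEdges f p) ∩ vertices (mapEdges f r)
      = (vertices p ∩ vertices r).image f := by
    rw [vertices_mapEdges, vertices_mapEdges, Finset.image_inter _ _ hf]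
  have hjoined : (∃ e ∈ mapEdges f p ∪ mapEdges f r,
      e.toFinset = vertices (mapEdges f p) ∩ vertices (mapEdges f r)) ↔
      ∃ e ∈ p ∪ r, e.toFinset = vertices p ∩ vertices r := by
    rw [hvertices, mapEdges, mapEdges, ← Finset.image_union, Finset.exists_mem_image]
    simp only [toFinset_map, (Finset.image_injective hf).eq_iff]
  simp only [typeOf, hedges, hjoined]
  rw [hvertices, Finset.card_image_of_injective _ hf]

variable [Fintype V] {G : SimpleGraph V} [DecidableRel G.Adj]

theorem pair_mem_indepPairs {s t u v : V} :
    ({s(s, t), s(u, v)} : Finset (Sym2 V)) ∈ indepPairs G ↔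
      G.Adj s t ∧ G.Adj u v ∧ [s, t, u, v].Nodup := by
  have hdisj : Disjoint (s(s, t)).toFinset (s(u, v)).toFinset ↔
      s ≠ u ∧ s ≠ v ∧ t ≠ u ∧ t ≠ v := by
    simp only [Finset.disjoint_left, Sym2.mem_toFinset, Sym2.mem_iff]
    grind
  have hnodup : G.Adj s t → G.Adj u v → ([s, t, u, v].Nodup ↔
      Disjoint (s(s, t)).toFinset (s(u, v)).toFinset) := by
    intro hst huv
    simp [hdisj, hst.ne, huv.ne]
    tauto
  rw [indepPairs, Finset.mem_filter, Finset.mem_powersetCard]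
  constructor
  · rintro ⟨⟨hsub, hcard⟩, hindep⟩
    have hne : s(s, t) ≠ s(u, v) := fun h => by simp [h] at hcard
    have hst : G.Adj s t := by simpa using hsub (Finset.mem_insert_self _ _)
    have huv : G.Adj u v := by
      simpa using hsub (Finset.mem_insert_of_mem (Finset.mem_singleton_self _))
    exact ⟨hst, huv, (hnodup hst huv).2 (hindep _ (by simp) _ (by simp) hne)⟩
  · rintro ⟨hst, huv, h⟩
    have hd := (hnodup hst huv).1 h
    have hne : s(s, t) ≠ s(u, v) := by
      have := hdisj.1 hd
      simp [this]
    refine ⟨⟨by simp [Finset.insert_subset_iff, hst, huv], Finset.card_pair hne⟩, ?_⟩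
    simp only [Finset.mem_insert, Finset.mem_singleton]
    rintro e (rfl | rfl) f (rfl | rfl) hef
    exacts [absurd rfl hef, hd, hd.symm, absurd rfl hef]

theorem pair_mem_indepPairs_top {s t u v : V} :
    ({s(s, t), s(u, v)} : Finset (Sym2 V)) ∈ indepPairs (⊤ : SimpleGraph V) ↔
      [s, t, u, v].Nodup := by
  rw [pair_mem_indepPairs]
  simp
  tauto

theorem exists_eq_pair {p : Finset (Sym2 V)} (hp : p ∈ indepPairs G) :
    ∃ s t u v, p = {s(s, t), s(u, v)} := by
  obtain ⟨e, f, -, rfl⟩ :=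
    Finset.card_eq_two.1 (Finset.mem_powersetCard.1 (Finset.mem_filter.1 hp).1).2
  induction e with | _ s t
  induction f with | _ u v
  exact ⟨s, t, u, v, rfl⟩

theorem exists_nodup_eq_pair {p : Finset (Sym2 V)} (hp : p ∈ indepPairs (⊤ : SimpleGraph V)) :
    ∃ s t u v, [s, t, u, v].Nodup ∧ p = {s(s, t), s(u, v)} := by
  obtain ⟨s, t, u, v, rfl⟩ := exists_eq_pair hp
  exact ⟨s, t, u, v, pair_mem_indepPairs_top.1 hp, rfl⟩

theorem mem_indepPairs_iff_subset {p : Finset (Sym2 V)} :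
    p ∈ indepPairs G ↔ p ∈ indepPairs (⊤ : SimpleGraph V) ∧ p ⊆ G.edgeFinset := by
  have hle : G.edgeFinset ⊆ (⊤ : SimpleGraph V).edgeFinset := SimpleGraph.edgeFinset_mono le_top
  simp only [indepPairs, Finset.mem_filter, Finset.mem_powersetCard]
  exact ⟨fun h => ⟨⟨⟨h.1.1.trans hle, h.1.2⟩, h.2⟩, h.1.1⟩, fun h => ⟨⟨h.2, h.1.1.2⟩, h.1.2⟩⟩

theorem mapEdges_mem_indepPairs_top [Fintype W] [DecidableEq W] {f : W → V}
    (hf : Function.Injective f) {p : Finset (Sym2 W)}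
    (hp : p ∈ indepPairs (⊤ : SimpleGraph W)) :
    mapEdges f p ∈ indepPairs (⊤ : SimpleGraph V) := by
  obtain ⟨s, t, u, v, h, rfl⟩ := exists_nodup_eq_pair hp
  rw [mapEdges_pair, pair_mem_indepPairs_top]
  exact h.map hf

theorem exists_eq_of_mem_vertices {p : Finset (Sym2 V)}
    (hp : p ∈ indepPairs (⊤ : SimpleGraph V)) {s : V} (hs : s ∈ vertices p) :
    ∃ t u v, [s, t, u, v].Nodup ∧ p = {s(s, t), s(u, v)} := by
  obtain ⟨a, b, c, d, h, rfl⟩ := exists_nodup_eq_pair hp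
  simp only [vertices_pair, Finset.mem_insert, Finset.mem_singleton] at hs
  rcases hs with rfl | rfl | rfl | rfl
  · exact ⟨b, c, d, h, rfl⟩
  · exact ⟨a, c, d, by grind, by rw [Sym2.eq_swap]⟩
  · exact ⟨d, a, b, by grind, by rw [Finset.pair_comm]⟩
  · exact ⟨c, a, b, by grind, by rw [Finset.pair_comm, Sym2.eq_swap]⟩

theorem exists_eq_of_two_mem_vertices {p : Finset (Sym2 V)}
    (hp : p ∈ indepPairs (⊤ : SimpleGraph V)) {s x : V} (hs : s ∈ vertices p)
    (hx : x ∈ vertices p) (hsx : s ≠ x) :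
    ∃ u v, [s, x, u, v].Nodup ∧ (p = {s(s, x), s(u, v)} ∨ p = {s(s, u), s(x, v)}) := by
  obtain ⟨t, u, v, h, rfl⟩ := exists_eq_of_mem_vertices hp hs
  simp only [vertices_pair, Finset.mem_insert, Finset.mem_singleton] at hx
  rcases hx with rfl | rfl | rfl | rfl
  · exact absurd rfl hsx
  · exact ⟨u, v, h, .inl rfl⟩
  · exact ⟨t, v, by grind, .inr rfl⟩
  · exact ⟨t, u, by grind, .inr (by rw [Sym2.eq_swap (a := u)])⟩

theorem exists_eq_of_three_mem_vertices {p : Finset (Sym2 V)}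
    (hp : p ∈ indepPairs (⊤ : SimpleGraph V)) {x y z : V} (hx : x ∈ vertices p)
    (hy : y ∈ vertices p) (hz : z ∈ vertices p) (hxyz : [x, y, z].Nodup) :
    ∃ v, [x, y, z, v].Nodup ∧ (p = {s(x, y), s(z, v)} ∨ p = {s(x, z), s(y, v)} ∨
      p = {s(y, z), s(x, v)}) := by
  obtain ⟨u, v, h, rfl | rfl⟩ := exists_eq_of_two_mem_vertices hp hx hy (by grind)
  · simp only [vertices_pair, Finset.mem_insert, Finset.mem_singleton] at hz
    obtain rfl | rfl : z = u ∨ z = v := by grind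
    · exact ⟨v, h, .inl rfl⟩
    · exact ⟨u, by grind, .inl (by rw [Sym2.eq_swap (a := u)])⟩
  · simp only [vertices_pair, Finset.mem_insert, Finset.mem_singleton] at hz
    obtain rfl | rfl : z = u ∨ z = v := by grind
    · exact ⟨v, h, .inr (.inl rfl)⟩
    · exact ⟨u, by grind, .inr (.inr (Finset.pair_comm _ _))⟩

end Pairs

section Patterns

variable {V : Type*} [DecidableEq V]

/-- The number of vertices covered by two pairs of independent edges of the given type. -/
def patSize : PairType → ℕ
  | t00 => 8 | t24 => 4 | t13 => 5 | t12 => 6 | t04 => 4 | t03 => 5 | t021 => 6 | t022 => 6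
  | t01 => 7

/-- The first component of the standard example of two pairs of independent edges of a type. The
standard example lives on the vertices `0, …, patSize ω - 1` and covers all of them. -/
def patFst : (ω : PairType) → Finset (Sym2 (Fin (patSize ω)))
  | t00 => ({s(0, 1), s(2, 3)} : Finset (Sym2 (Fin 8)))
  | t24 => ({s(0, 1), s(2, 3)} : Finset (Sym2 (Fin 4)))
  | t13 => ({s(0, 1), s(2, 3)} : Finset (Sym2 (Fin 5)))
  | t12 => ({s(0, 1), s(2, 3)} : Finset (Sym2 (Fin 6)))
  | t04 => ({s(0, 1), s(2, 3)} : Finset (Sym2 (Fin 4)))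
  | t03 => ({s(0, 1), s(2, 3)} : Finset (Sym2 (Fin 5)))
  | t021 => ({s(0, 1), s(2, 3)} : Finset (Sym2 (Fin 6)))
  | t022 => ({s(0, 1), s(2, 3)} : Finset (Sym2 (Fin 6)))
  | t01 => ({s(0, 1), s(2, 3)} : Finset (Sym2 (Fin 7)))

/-- The second component of the standard example of two pairs of independent edges of a type. -/
def patSnd : (ω : PairType) → Finset (Sym2 (Fin (patSize ω)))
  | t00 => ({s(4, 5), s(6, 7)} : Finset (Sym2 (Fin 8)))
  | t24 => ({s(0, 1), s(2, 3)} : Finset (Sym2 (Fin 4)))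
  | t13 => ({s(0, 1), s(2, 4)} : Finset (Sym2 (Fin 5)))
  | t12 => ({s(0, 1), s(4, 5)} : Finset (Sym2 (Fin 6)))
  | t04 => ({s(0, 2), s(1, 3)} : Finset (Sym2 (Fin 4)))
  | t03 => ({s(0, 2), s(3, 4)} : Finset (Sym2 (Fin 5)))
  | t021 => ({s(0, 2), s(4, 5)} : Finset (Sym2 (Fin 6)))
  | t022 => ({s(0, 4), s(2, 5)} : Finset (Sym2 (Fin 6)))
  | t01 => ({s(0, 4), s(5, 6)} : Finset (Sym2 (Fin 7)))

theorem typeOf_pat (ω : PairType) : typeOf (patFst ω) (patSnd ω) = ω := by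
  cases ω <;> decide

theorem patFst_mem (ω : PairType) :
    patFst ω ∈ indepPairs (⊤ : SimpleGraph (Fin (patSize ω))) := by
  cases ω <;> exact pair_mem_indepPairs_top.2 (by decide)

theorem patSnd_mem (ω : PairType) :
    patSnd ω ∈ indepPairs (⊤ : SimpleGraph (Fin (patSize ω))) := by
  cases ω <;> exact pair_mem_indepPairs_top.2 (by decide)

theorem vertices_pat (ω : PairType) : vertices (patFst ω) ∪ vertices (patSnd ω) = Finset.univ := by
  cases ω <;> decide

/-- `(p, r)` is the image of the standard example of type `ω` under an embedding. -/
def IsPattern (ω : PairType) (p r : Finset (Sym2 V)) : Prop :=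
  ∃ f : Fin (patSize ω) → V, Function.Injective f ∧
    mapEdges f (patFst ω) = p ∧ mapEdges f (patSnd ω) = r

theorem IsPattern.typeOf_eq {ω : PairType} {p r : Finset (Sym2 V)} (h : IsPattern ω p r) :
    typeOf p r = ω := by
  obtain ⟨f, hf, rfl, rfl⟩ := h
  rw [typeOf_mapEdges hf, typeOf_pat]

variable [Fintype V] {p : Finset (Sym2 V)} {x y z w : V}

theorem isPattern_of_no_common_vertex (hp : p ∈ indepPairs (⊤ : SimpleGraph V))
    (hr : [x, y, z, w].Nodup) (hx : x ∉ vertices p) (hy : y ∉ vertices p) (hz : z ∉ vertices p)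
    (hw : w ∉ vertices p) : IsPattern t00 p {s(x, y), s(z, w)} := by
  obtain ⟨s, t, u, v, hp, rfl⟩ := exists_nodup_eq_pair hp
  simp only [vertices_pair, Finset.mem_insert, Finset.mem_singleton] at hx hy hz hw
  have : [s, t, u, v, x, y, z, w].Nodup := by grind
  exact ⟨![s, t, u, v, x, y, z, w], List.nodup_ofFn.1 this, mapEdges_pair .., mapEdges_pair ..⟩

theorem isPattern_of_one_common_vertex (hp : p ∈ indepPairs (⊤ : SimpleGraph V))
    (hr : [x, y, z, w].Nodup) (hx : x ∈ vertices p) (hy : y ∉ vertices p) (hz : z ∉ vertices p)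
    (hw : w ∉ vertices p) : IsPattern t01 p {s(x, y), s(z, w)} := by
  obtain ⟨t, u, v, hp, rfl⟩ := exists_eq_of_mem_vertices hp hx
  simp only [vertices_pair, Finset.mem_insert, Finset.mem_singleton] at hy hz hw
  have : [x, t, u, v, y, z, w].Nodup := by grind
  exact ⟨![x, t, u, v, y, z, w], List.nodup_ofFn.1 this, mapEdges_pair .., mapEdges_pair ..⟩

theorem isPattern_of_two_common_vertices (hp : p ∈ indepPairs (⊤ : SimpleGraph V))
    (hr : [x, y, z, w].Nodup) (hx : x ∈ vertices p) (hy : y ∉ vertices p) (hz : z ∈ vertices p)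
    (hw : w ∉ vertices p) :
    IsPattern t021 {s(x, y), s(z, w)} p ∨ IsPattern t022 p {s(x, y), s(z, w)} := by
  obtain ⟨u, v, hp, rfl | rfl⟩ := exists_eq_of_two_mem_vertices hp hx hz (by grind) <;>
    simp only [vertices_pair, Finset.mem_insert, Finset.mem_singleton] at hy hw
  · have : [x, y, z, w, u, v].Nodup := by grind
    exact .inl ⟨![x, y, z, w, u, v], List.nodup_ofFn.1 this, mapEdges_pair .., mapEdges_pair ..⟩
  · have : [x, u, z, v, y, w].Nodup := by grind
    exact .inr ⟨![x, u, z, v, y, w], List.nodup_ofFn.1 this, mapEdges_pair .., mapEdges_pair ..⟩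

theorem isPattern_of_two_common_adjacent_vertices (hp : p ∈ indepPairs (⊤ : SimpleGraph V))
    (hr : [x, y, z, w].Nodup) (hx : x ∈ vertices p) (hy : y ∈ vertices p) (hz : z ∉ vertices p)
    (hw : w ∉ vertices p) :
    IsPattern t12 p {s(x, y), s(z, w)} ∨ IsPattern t021 p {s(x, y), s(z, w)} := by
  obtain ⟨u, v, hp, rfl | rfl⟩ := exists_eq_of_two_mem_vertices hp hx hy (by grind) <;>
    simp only [vertices_pair, Finset.mem_insert, Finset.mem_singleton] at hz hw
  · have : [x, y, u, v, z, w].Nodup := by grind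
    exact .inl ⟨![x, y, u, v, z, w], List.nodup_ofFn.1 this, mapEdges_pair .., mapEdges_pair ..⟩
  · have : [x, u, y, v, z, w].Nodup := by grind
    exact .inr ⟨![x, u, y, v, z, w], List.nodup_ofFn.1 this, mapEdges_pair .., mapEdges_pair ..⟩

theorem isPattern_of_three_common_vertices (hp : p ∈ indepPairs (⊤ : SimpleGraph V))
    (hr : [x, y, z, w].Nodup) (hx : x ∈ vertices p) (hy : y ∈ vertices p) (hz : z ∈ vertices p)
    (hw : w ∉ vertices p) :
    IsPattern t13 p {s(x, y), s(z, w)} ∨ IsPattern t03 p {s(x, y), s(z, w)} := by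
  obtain ⟨v, hp, rfl | rfl | rfl⟩ := exists_eq_of_three_mem_vertices hp hx hy hz (by grind) <;>
    simp only [vertices_pair, Finset.mem_insert, Finset.mem_singleton] at hw
  · have : [x, y, z, v, w].Nodup := by grind
    exact .inl ⟨![x, y, z, v, w], List.nodup_ofFn.1 this, mapEdges_pair .., mapEdges_pair ..⟩
  · have : [y, v, x, z, w].Nodup := by grind
    rw [Finset.pair_comm, Sym2.eq_swap (a := x) (b := y)]
    exact .inr ⟨![y, v, x, z, w], List.nodup_ofFn.1 this, mapEdges_pair .., mapEdges_pair ..⟩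
  · have : [x, v, y, z, w].Nodup := by grind
    rw [Finset.pair_comm]
    exact .inr ⟨![x, v, y, z, w], List.nodup_ofFn.1 this, mapEdges_pair .., mapEdges_pair ..⟩

theorem isPattern_of_four_common_vertices (hp : p ∈ indepPairs (⊤ : SimpleGraph V))
    (hr : [x, y, z, w].Nodup) (hx : x ∈ vertices p) (hy : y ∈ vertices p) (hz : z ∈ vertices p)
    (hw : w ∈ vertices p) :
    IsPattern t24 p {s(x, y), s(z, w)} ∨ IsPattern t04 p {s(x, y), s(z, w)} := by
  obtain ⟨v, -, hp⟩ := exists_eq_of_three_mem_vertices hp hx hy hz (by grind)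
  obtain rfl : w = v := by
    rcases hp with rfl | rfl | rfl <;>
      simp only [vertices_pair, Finset.mem_insert, Finset.mem_singleton] at hw <;> grind
  rcases hp with rfl | rfl | rfl
  · exact .inl ⟨![x, y, z, w], List.nodup_ofFn.1 hr, mapEdges_pair .., mapEdges_pair ..⟩
  · have : [x, z, y, w].Nodup := by grind
    exact .inr ⟨![x, z, y, w], List.nodup_ofFn.1 this, mapEdges_pair .., mapEdges_pair ..⟩
  · have : [y, z, x, w].Nodup := by grind
    rw [Sym2.eq_swap (a := x) (b := y)]
    exact .inr ⟨![y, z, x, w], List.nodup_ofFn.1 this, mapEdges_pair .., mapEdges_pair ..⟩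

theorem exists_eq_pair_sorted (P : Finset V) {r : Finset (Sym2 V)}
    (hr : r ∈ indepPairs (⊤ : SimpleGraph V)) :
    ∃ x y z w, [x, y, z, w].Nodup ∧ r = {s(x, y), s(z, w)} ∧
      (y ∈ P → x ∈ P) ∧ (z ∈ P → x ∈ P) ∧ (w ∈ P → y ∈ P ∧ z ∈ P) := by
  have horient : ∀ e : Sym2 V, ∃ x y, e = s(x, y) ∧ (y ∈ P → x ∈ P) := by
    intro e
    induction e with | _ x y
    by_cases hx : x ∈ P
    · exact ⟨x, y, rfl, fun _ => hx⟩
    · exact ⟨y, x, Sym2.eq_swap, fun h => absurd h hx⟩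
  obtain ⟨a, b, c, d, rfl⟩ := exists_eq_pair hr
  obtain ⟨x, y, hab, hyx⟩ := horient s(a, b)
  obtain ⟨z, w, hcd, hwz⟩ := horient s(c, d)
  rw [hab, hcd] at hr ⊢
  have h := pair_mem_indepPairs_top.1 hr
  by_cases hle : (z ∈ P → x ∈ P) ∧ (w ∈ P → y ∈ P)
  · exact ⟨x, y, z, w, h, rfl, by tauto⟩
  · exact ⟨z, w, x, y, by grind, Finset.pair_comm _ _, by tauto⟩

theorem exists_isPattern {r : Finset (Sym2 V)} (hp : p ∈ indepPairs (⊤ : SimpleGraph V))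
    (hr : r ∈ indepPairs (⊤ : SimpleGraph V)) : ∃ ω, IsPattern ω p r ∨ IsPattern ω r p := by
  obtain ⟨x, y, z, w, h, rfl, hyx, hzx, hwyz⟩ := exists_eq_pair_sorted (vertices p) hr
  by_cases hx : x ∈ vertices p
  · by_cases hy : y ∈ vertices p <;> by_cases hz : z ∈ vertices p
    · by_cases hw : w ∈ vertices p
      · exact (isPattern_of_four_common_vertices hp h hx hy hz hw).elim
          (⟨_, .inl ·⟩) (⟨_, .inl ·⟩)
      · exact (isPattern_of_three_common_vertices hp h hx hy hz hw).elim
          (⟨_, .inl ·⟩) (⟨_, .inl ·⟩)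
    · exact (isPattern_of_two_common_adjacent_vertices hp h hx hy hz fun hw => hz (hwyz hw).2).elim
        (⟨_, .inl ·⟩) (⟨_, .inl ·⟩)
    · exact (isPattern_of_two_common_vertices hp h hx hy hz fun hw => hy (hwyz hw).1).elim
        (⟨_, .inr ·⟩) (⟨_, .inl ·⟩)
    · exact ⟨_, .inl (isPattern_of_one_common_vertex hp h hx hy hz fun hw => hy (hwyz hw).1)⟩
  · exact ⟨_, .inl (isPattern_of_no_common_vertex hp h hx (mt hyx hx) (mt hzx hx)
      fun hw => hx (hzx (hwyz hw).2))⟩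

theorem isPattern_typeOf {r : Finset (Sym2 V)} (hp : p ∈ indepPairs (⊤ : SimpleGraph V))
    (hr : r ∈ indepPairs (⊤ : SimpleGraph V)) :
    IsPattern (typeOf p r) p r ∨ IsPattern (typeOf p r) r p := by
  obtain ⟨ω, h | h⟩ := exists_isPattern hp hr
  · exact .inl (h.typeOf_eq.symm ▸ h)
  · exact .inr (by rw [typeOf_comm]; exact h.typeOf_eq.symm ▸ h)

end Patterns

section Degrees

variable {V : Type*} {G : SimpleGraph V} [DecidableRel G.Adj]

theorem a_eq (u v : V) : a G u v = if G.Adj u v then 1 else 0 := by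
  simp [a, SimpleGraph.adjMatrix_apply]

theorem a_comm (u v : V) : a G u v = a G v u := by
  simp only [a_eq, G.adj_comm]

theorem k_eq_sum [Fintype V] (v : V) : k G v = ∑ w, a G v w := by
  simp [k, a_eq, SimpleGraph.card_neighborFinset_eq_degree, ← SimpleGraph.neighborFinset_eq_filter]

theorem two_mul_m [Fintype V] : 2 * m G = ∑ v, k G v := by
  simp only [m, k]
  exact_mod_cast (G.sum_degrees_eq_twice_card_edges).symm

end Degrees

section EmbeddingSums

variable {V : Type*} [Fintype V]

/-- A vertex either belongs to the range of a given embedding or extends it by a new point `0`. -/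
theorem sum_embedding_sum {n : ℕ} (g : (Fin n → V) → V → ℝ) :
    ∑ f : Fin n ↪ V, ∑ w, g f w = ∑ f : Fin n ↪ V, ∑ i, g f (f i)
      + ∑ f : Fin (n + 1) ↪ V, g (f ∘ Fin.succ) (f 0) := by
  classical
  have hrange : ∀ f : Fin n ↪ V, ∑ w : {w // w ∈ Set.range f}, g f w = ∑ i, g f (f i) := fun f =>
    ((Equiv.ofInjective f f.injective).sum_comp fun w : Set.range f => g f w).symm
  have hnew : ∑ f : Fin (n + 1) ↪ V, g (f ∘ Fin.succ) (f 0)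
      = ∑ f : Fin n ↪ V, ∑ w : {w // w ∉ Set.range f}, g f w := by
    rw [← Fintype.sum_sigma' fun (f : Fin n ↪ V) (w : {w // w ∉ Set.range f}) => g f w]
    exact Fintype.sum_equiv (Equiv.embeddingFinSucc n V) _ _ fun f => rfl
  rw [hnew, ← Finset.sum_add_distrib]
  refine Finset.sum_congr rfl fun f _ => ?_
  rw [← hrange]
  convert (Fintype.sum_subtype_add_sum_subtype (· ∈ Set.range f) (g f)).symm

theorem sum_embedding_comp {n : ℕ} (g : Fin n → Fin n) (hg : Function.Injective g)
    (F : (Fin n → V) → ℝ) : ∑ f : Fin n ↪ V, F (f ∘ g) = ∑ f : Fin n ↪ V, F f :=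
  Fintype.sum_equiv
    (Equiv.embeddingCongr (Equiv.ofBijective g (Finite.injective_iff_bijective.1 hg)).symm
      (Equiv.refl V)) _ _ fun _ => rfl

/-- Every neighbour of the image of `i` either is the image of some `j` or is a new vertex. -/
theorem sum_degree_mul {G : SimpleGraph V} [DecidableRel G.Adj] {n : ℕ} (i : Fin n)
    (F : (Fin n → V) → ℝ) :
    ∑ f : Fin n ↪ V, k G (f i) * F f = ∑ j, ∑ f : Fin n ↪ V, a G (f i) (f j) * F f
      + ∑ f : Fin (n + 1) ↪ V, a G (f i.succ) (f 0) * F (f ∘ Fin.succ) := by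
  simp only [k_eq_sum, Finset.sum_mul]
  rw [sum_embedding_sum fun f w => a G (f i) w * F f,
    Finset.sum_comm (s := Finset.univ (α := Fin n))]
  rfl

variable [DecidableEq V] (G : SimpleGraph V) [DecidableRel G.Adj]

/-- The indicator that `f` maps the edges in `E` to edges of `G`. -/
noncomputable def edgeInd {n : ℕ} (E : Finset (Sym2 (Fin n))) (f : Fin n → V) : ℝ :=
  if mapEdges f E ⊆ G.edgeFinset then 1 else 0

/-- The sum, over the embeddings of `Fin n` into the vertices that map the edges in `E` to edges of
`G`, of the product of the degrees of the images of the elements of `D`. For `D = 0`, this is the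
number of labelled copies of `E` in `G`. -/
noncomputable def embSum {n : ℕ} (E : Finset (Sym2 (Fin n))) (D : Multiset (Fin n)) : ℝ :=
  ∑ f : Fin n ↪ V, (D.map fun i => k G (f i)).prod * edgeInd G E f

variable {G}

theorem edgeInd_insert {n : ℕ} (E : Finset (Sym2 (Fin n))) (i j : Fin n) (f : Fin n → V) :
    edgeInd G (insert s(i, j) E) f = a G (f i) (f j) * edgeInd G E f := by
  simp only [edgeInd, a_eq, mapEdges, Finset.image_insert, Finset.insert_subset_iff, Sym2.map_mk,
    SimpleGraph.mem_edgeFinset, SimpleGraph.mem_edgeSet, ite_and]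
  split_ifs <;> simp_all

theorem edgeInd_empty {n : ℕ} (f : Fin n → V) : edgeInd G ∅ f = 1 := by
  simp [edgeInd, mapEdges]

theorem edgeInd_mapEdges {n l : ℕ} (g : Fin l → Fin n) (E : Finset (Sym2 (Fin l)))
    (f : Fin n → V) : edgeInd G (mapEdges g E) f = edgeInd G E (f ∘ g) := by
  simp [edgeInd, mapEdges_mapEdges]

theorem embSum_zero {n : ℕ} (E : Finset (Sym2 (Fin n))) :
    embSum G E 0 = ∑ f : Fin n ↪ V, edgeInd G E f := by
  simp [embSum]

theorem embSum_reindex {n : ℕ} {E E' : Finset (Sym2 (Fin n))} {D D' : Multiset (Fin n)}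
    (g : Fin n → Fin n) (hg : Function.Injective g := by decide)
    (hE : mapEdges g E = E' := by decide) (hD : D.map g = D' := by rfl) :
    embSum G E D = embSum G E' D' := by
  simp only [embSum, ← hE, ← hD, edgeInd_mapEdges, Multiset.map_map]
  exact (sum_embedding_comp g hg fun f => (D.map fun i => k G (f i)).prod * edgeInd G E f).symm

theorem embSum_zero_reindex {n : ℕ} {E E' : Finset (Sym2 (Fin n))} (g : Fin n → Fin n)
    (hg : Function.Injective g := by decide) (hE : mapEdges g E = E' := by decide) :
    embSum G E 0 = embSum G E' 0 :=
  embSum_reindex g hg hE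

theorem embSum_of_diag_mem {n : ℕ} {E : Finset (Sym2 (Fin n))} {D : Multiset (Fin n)} (i : Fin n)
    (h : s(i, i) ∈ E := by decide) : embSum G E D = 0 := by
  rw [embSum, ← Finset.insert_eq_of_mem h]
  simp [edgeInd_insert, a_eq]

theorem embSum_cons {n : ℕ} (E : Finset (Sym2 (Fin n))) (i : Fin n) (D : Multiset (Fin n)) :
    embSum G E (i ::ₘ D) = ∑ j, embSum G (insert s(i, j) E) D
      + embSum G (insert s(i.succ, 0) (mapEdges Fin.succ E)) (D.map Fin.succ) := by
  simp only [embSum, Multiset.map_cons, Multiset.prod_cons, Multiset.map_map, edgeInd_insert,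
    edgeInd_mapEdges, mul_assoc, mul_left_comm _ (a G _ _)]
  exact sum_degree_mul i fun f => (D.map fun i => k G (f i)).prod * edgeInd G E f

theorem embSum_singleton {n : ℕ} (E : Finset (Sym2 (Fin n))) (i : Fin n) :
    embSum G E {i} = ∑ j, embSum G (insert s(i, j) E) 0
      + embSum G (insert s(i.succ, 0) (mapEdges Fin.succ E)) 0 :=
  embSum_cons E i 0

theorem embSum_pair {n : ℕ} (E : Finset (Sym2 (Fin n))) (i j : Fin n) :
    embSum G E {i, j} = ∑ l, embSum G (insert s(i, l) E) {j}
      + embSum G (insert s(i.succ, 0) (mapEdges Fin.succ E)) {j.succ} :=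
  embSum_cons E i {j}

theorem two_mul_m_mul_embSum {n : ℕ} (E : Finset (Sym2 (Fin n))) :
    2 * m G * embSum G E 0 = ∑ j, embSum G E {j} + embSum G (mapEdges Fin.succ E) {0} := by
  simp only [embSum, Multiset.map_singleton, Multiset.prod_singleton, Multiset.map_zero,
    Multiset.prod_zero, one_mul, edgeInd_mapEdges, two_mul_m, Finset.mul_sum, Finset.sum_mul]
  rw [sum_embedding_sum fun f w => k G w * edgeInd G E f,
    Finset.sum_comm (s := Finset.univ (α := Fin n))]

end EmbeddingSums

section Symmetry

variable {V : Type*}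

theorem card_embedding_eq_card_perm [Fintype V] {n : ℕ} (f : Fin n ↪ V) (P : (Fin n → V) → Prop)
    [DecidablePred P] (hP : ∀ g : Fin n ↪ V, P g → Set.range g ⊆ Set.range f) :
    (Finset.univ.filter fun g : Fin n ↪ V => P g).card
      = (Finset.univ.filter fun σ : Equiv.Perm (Fin n) => P (f ∘ σ)).card := by
  symm
  refine Finset.card_bij (fun σ _ => σ.toEmbedding.trans f) ?_ ?_ ?_
  · intro σ hσ
    exact Finset.mem_filter.2 ⟨Finset.mem_univ _, (Finset.mem_filter.1 hσ).2⟩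
  · intro σ _ τ _ hστ
    exact Equiv.ext fun i => f.injective (DFunLike.congr_fun hστ i)
  · intro g hg
    have hg := (Finset.mem_filter.1 hg).2
    choose j hj using fun i => hP g hg (Set.mem_range_self i)
    have hinj : Function.Injective j := fun x y hxy => g.injective (by rw [← hj x, ← hj y, hxy])
    refine ⟨Equiv.ofBijective j (Finite.injective_iff_bijective.1 hinj), ?_, ?_⟩
    · rw [← funext hj] at hg
      exact Finset.mem_filter.2 ⟨Finset.mem_univ _, hg⟩
    · ext i; exact hj i

variable [DecidableEq V]

theorem vertices_union (p r : Finset (Sym2 V)) : vertices (p ∪ r) = vertices p ∪ vertices r := by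
  simp [vertices, Finset.union_biUnion]

theorem mapEdges_union {W : Type*} [DecidableEq W] (f : W → V) (p r : Finset (Sym2 W)) :
    mapEdges f (p ∪ r) = mapEdges f p ∪ mapEdges f r := Finset.image_union _ _

theorem range_subset_of_mapEdges_eq {n : ℕ} {E E' : Finset (Sym2 (Fin n))}
    (hE : vertices E = Finset.univ) {f g : Fin n → V} (h : mapEdges g E = mapEdges f E') :
    Set.range g ⊆ Set.range f := by
  have hv := congrArg vertices h
  rw [vertices_mapEdges, vertices_mapEdges, hE] at hv
  rintro _ ⟨i, rfl⟩
  obtain ⟨j, -, hj⟩ := Finset.mem_image.1 (hv ▸ Finset.mem_image_of_mem g (Finset.mem_univ i))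
  exact ⟨j, hj⟩

/-- The number of permutations that fix both components of the standard example of type `ω`, plus
the number of those that exchange them. -/
def patSymm (ω : PairType) : ℕ :=
  (Finset.univ.filter fun σ : Equiv.Perm (Fin (patSize ω)) =>
    mapEdges σ (patFst ω) = patFst ω ∧ mapEdges σ (patSnd ω) = patSnd ω).card
  + (Finset.univ.filter fun σ : Equiv.Perm (Fin (patSize ω)) =>
    mapEdges σ (patFst ω) = patSnd ω ∧ mapEdges σ (patSnd ω) = patFst ω).card

variable [Fintype V]

/-- The embeddings that map the standard example of type `ω` to `(p, r)`. -/
noncomputable def patEmbeddings (ω : PairType) (p r : Finset (Sym2 V)) :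
    Finset (Fin (patSize ω) ↪ V) :=
  {f | mapEdges f (patFst ω) = p ∧ mapEdges f (patSnd ω) = r}

theorem card_patEmbeddings_mapEdges {ω : PairType} (f : Fin (patSize ω) ↪ V)
    (E E' : Finset (Sym2 (Fin (patSize ω)))) :
    (patEmbeddings ω (mapEdges f E) (mapEdges f E')).card
      = (Finset.univ.filter fun σ : Equiv.Perm (Fin (patSize ω)) =>
          mapEdges σ (patFst ω) = E ∧ mapEdges σ (patSnd ω) = E').card := by
  rw [patEmbeddings, card_embedding_eq_card_perm f fun g =>
    mapEdges g (patFst ω) = mapEdges f E ∧ mapEdges g (patSnd ω) = mapEdges f E']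
  · simp only [← mapEdges_mapEdges, (mapEdges_injective f.injective).eq_iff]
  · intro g hg
    refine range_subset_of_mapEdges_eq ((vertices_union _ _).trans (vertices_pat ω))
      (E' := E ∪ E') ?_
    rw [mapEdges_union, mapEdges_union, hg.1, hg.2]

theorem card_patEmbeddings_add_swap {p r : Finset (Sym2 V)}
    (hp : p ∈ indepPairs (⊤ : SimpleGraph V)) (hr : r ∈ indepPairs (⊤ : SimpleGraph V)) :
    (patEmbeddings (typeOf p r) p r).card + (patEmbeddings (typeOf p r) r p).card
      = patSymm (typeOf p r) := by
  have hpattern := isPattern_typeOf hp hr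
  generalize typeOf p r = ω at hpattern ⊢
  rcases hpattern with ⟨f, hf, rfl, rfl⟩ | ⟨f, hf, rfl, rfl⟩
  · simp only [patSymm, ← card_patEmbeddings_mapEdges ⟨f, hf⟩]
    rfl
  · rw [add_comm]
    simp only [patSymm, ← card_patEmbeddings_mapEdges ⟨f, hf⟩]
    rfl

variable (G : SimpleGraph V) [DecidableRel G.Adj]

theorem mapEdges_pat_mem_indepPairs {ω : PairType} (f : Fin (patSize ω) ↪ V) :
    (mapEdges f (patFst ω) ∈ indepPairs G ∧ mapEdges f (patSnd ω) ∈ indepPairs G) ↔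
      mapEdges f (patFst ω ∪ patSnd ω) ⊆ G.edgeFinset := by
  rw [mapEdges_union, Finset.union_subset_iff, mem_indepPairs_iff_subset (G := G),
    mem_indepPairs_iff_subset (G := G)]
  have hfst := mapEdges_mem_indepPairs_top f.injective (patFst_mem ω)
  have hsnd := mapEdges_mem_indepPairs_top f.injective (patSnd_mem ω)
  tauto

/-- The elements of `Q × Q` of type `ω`. -/
def pairsOfType (ω : PairType) : Finset (Finset (Sym2 V) × Finset (Sym2 V)) :=
  {x ∈ indepPairs G ×ˢ indepPairs G | typeOf x.1 x.2 = ω}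

theorem mem_pairsOfType {ω : PairType} {p r : Finset (Sym2 V)} :
    (p, r) ∈ pairsOfType G ω ↔ (p ∈ indepPairs G ∧ r ∈ indepPairs G) ∧ typeOf p r = ω := by
  simp [pairsOfType]

theorem embSum_pat_eq_sum_card (ω : PairType) : embSum G (patFst ω ∪ patSnd ω) 0
    = ∑ x ∈ pairsOfType G ω, ((patEmbeddings ω x.1 x.2).card : ℝ) := by
  have hmaps : ∀ f ∈ Finset.univ.filter fun f : Fin (patSize ω) ↪ V =>
      mapEdges f (patFst ω ∪ patSnd ω) ⊆ G.edgeFinset,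
      (mapEdges f (patFst ω), mapEdges f (patSnd ω)) ∈ pairsOfType G ω := by
    intro f hf
    refine (mem_pairsOfType G).2 ⟨?_, by rw [typeOf_mapEdges f.injective, typeOf_pat]⟩
    exact (mapEdges_pat_mem_indepPairs G f).2 (Finset.mem_filter.1 hf).2
  have hcard : embSum G (patFst ω ∪ patSnd ω) 0 = (Finset.univ.filter
      fun f : Fin (patSize ω) ↪ V => mapEdges f (patFst ω ∪ patSnd ω) ⊆ G.edgeFinset).card := by
    simp [embSum_zero, edgeInd]
  rw [hcard, Finset.card_eq_sum_card_fiberwise hmaps, Nat.cast_sum]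
  refine Finset.sum_congr rfl fun ⟨p, r⟩ hx => ?_
  congr 2
  ext f
  simp only [patEmbeddings, Finset.mem_filter, ← mapEdges_pat_mem_indepPairs, Prod.mk.injEq,
    Finset.mem_univ, true_and, and_iff_right_iff_imp]
  rintro ⟨rfl, rfl⟩
  exact ((mem_pairsOfType G).1 hx).1

theorem sum_pairsOfType_swap (ω : PairType) (F : Finset (Sym2 V) → Finset (Sym2 V) → ℝ) :
    ∑ x ∈ pairsOfType G ω, F x.2 x.1 = ∑ x ∈ pairsOfType G ω, F x.1 x.2 := by
  refine Finset.sum_nbij' Prod.swap Prod.swap ?_ ?_ ?_ ?_ ?_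
  all_goals simp [mem_pairsOfType, typeOf_comm]
  all_goals tauto

/-- Count the embeddings of the standard example by the pairs `(p, r)` to which they map it,
together with those that map it to `(r, p)`. -/
theorem patSymm_mul_freq (ω : PairType) :
    patSymm ω * freq G ω = 2 * embSum G (patFst ω ∪ patSnd ω) 0 := by
  calc patSymm ω * freq G ω
      = ∑ x ∈ pairsOfType G ω,
          ((patEmbeddings ω x.1 x.2).card + (patEmbeddings ω x.2 x.1).card : ℝ) := by
        rw [Finset.sum_congr rfl (g := fun _ => (patSymm ω : ℝ)), Finset.sum_const, nsmul_eq_mul,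
          mul_comm]
        · rfl
        · rintro ⟨p, r⟩ hx
          obtain ⟨⟨hp, hr⟩, rfl⟩ := (mem_pairsOfType G).1 hx
          exact_mod_cast card_patEmbeddings_add_swap (mem_indepPairs_iff_subset.1 hp).1
            (mem_indepPairs_iff_subset.1 hr).1
    _ = 2 * embSum G (patFst ω ∪ patSnd ω) 0 := by
        rw [Finset.sum_add_distrib,
          sum_pairsOfType_swap G ω fun p r => ((patEmbeddings ω p r).card : ℝ),
          ← embSum_pat_eq_sum_card, two_mul]

theorem patSymm_t24 : patSymm t24 = 16 := by decide +kernel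
theorem patSymm_t13 : patSymm t13 = 4 := by decide +kernel
theorem patSymm_t12 : patSymm t12 = 16 := by decide +kernel
theorem patSymm_t04 : patSymm t04 = 8 := by decide +kernel
theorem patSymm_t03 : patSymm t03 = 2 := by decide +kernel
theorem patSymm_t021 : patSymm t021 = 4 := by decide +kernel
theorem patSymm_t022 : patSymm t022 = 4 := by decide +kernel

end Symmetry

section EdgeSets

/-- The edges of an edge. -/
abbrev edgesL2 : Finset (Sym2 (Fin 2)) := {s(0, 1)}

/-- The edges of the path on three vertices. -/
abbrev edgesL3 : Finset (Sym2 (Fin 3)) := {s(0, 1), s(1, 2)}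

/-- The edges of two disjoint edges. -/
abbrev edges2L2 : Finset (Sym2 (Fin 4)) := {s(0, 1), s(2, 3)}

/-- The edges of the path on four vertices. -/
abbrev edgesL4 : Finset (Sym2 (Fin 4)) := {s(0, 1), s(1, 2), s(2, 3)}

/-- The edges of the cycle on four vertices. -/
abbrev edgesC4 : Finset (Sym2 (Fin 4)) := {s(0, 1), s(1, 2), s(2, 3), s(3, 0)}

/-- The edges of the paw. -/
abbrev edgesPaw : Finset (Sym2 (Fin 4)) := {s(0, 1), s(1, 2), s(0, 2), s(2, 3)}

/-- The edges of the path on five vertices. -/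
abbrev edgesL5 : Finset (Sym2 (Fin 5)) := {s(0, 1), s(1, 2), s(2, 3), s(3, 4)}

/-- The edges of the disjoint union of a triangle and an edge. -/
abbrev edgesC3L2 : Finset (Sym2 (Fin 5)) := {s(0, 1), s(1, 2), s(0, 2), s(3, 4)}

/-- The edges of the tree with degrees `3, 2, 1, 1, 1`. -/
abbrev edgesFork : Finset (Sym2 (Fin 5)) := {s(0, 1), s(1, 2), s(2, 3), s(1, 4)}

/-- The edges of the disjoint union of an edge and a path on three vertices. -/
abbrev edgesL2L3 : Finset (Sym2 (Fin 5)) := {s(0, 1), s(2, 3), s(2, 4)}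

/-- The edges of three disjoint edges. -/
abbrev edges3L2 : Finset (Sym2 (Fin 6)) := {s(0, 1), s(2, 3), s(4, 5)}

/-- The edges of the disjoint union of a path on four vertices and an edge. -/
abbrev edgesL4L2 : Finset (Sym2 (Fin 6)) := {s(0, 1), s(2, 3), s(0, 2), s(4, 5)}

/-- The edges of two disjoint paths on three vertices. -/
abbrev edges2L3 : Finset (Sym2 (Fin 6)) := {s(0, 1), s(2, 3), s(0, 4), s(2, 5)}

end EdgeSets

section CopyCount

variable {V W : Type*} {G : SimpleGraph V} {H : SimpleGraph W}

theorem exists_iso_toSubgraph (c : H.Copy G) {K : G.Subgraph} (hK : c.toSubgraph = K) :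
    ∃ e : H ≃g K.coe, ∀ i, (e i : V) = c i := by
  subst hK
  exact ⟨c.isoToSubgraph, fun _ => rfl⟩

theorem toSubgraph_comp_iso (c : H.Copy G) (σ : H ≃g H) :
    (c.comp σ.toCopy).toSubgraph = c.toSubgraph := by
  ext x y
  · have hverts : (∃ i, c i = x) ↔ ∃ i, c (σ i) = x := σ.surjective.exists
    simpa using hverts.symm
  · constructor
    · rintro ⟨i, j, hij, rfl, rfl⟩
      exact ⟨σ i, σ j, σ.map_rel_iff.2 hij, rfl, rfl⟩
    · rintro ⟨i, j, hij, rfl, rfl⟩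
      exact ⟨σ.symm i, σ.symm j, σ.symm.map_rel_iff.2 hij, by simp, by simp⟩

theorem exists_comp_iso_eq {c d : H.Copy G} (h : d.toSubgraph = c.toSubgraph) :
    ∃ σ : H ≃g H, c.comp σ.toCopy = d := by
  obtain ⟨e, he⟩ := exists_iso_toSubgraph c rfl
  obtain ⟨e', he'⟩ := exists_iso_toSubgraph d h
  refine ⟨e'.trans e.symm, SimpleGraph.Copy.ext fun i => ?_⟩
  calc c (e.symm (e' i)) = e (e.symm (e' i)) := (he _).symm
    _ = d i := by rw [e.apply_symm_apply, he']

theorem labelledCopyCount_eq_copyCount_mul [Fintype V] [Fintype W] (G : SimpleGraph V)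
    (H : SimpleGraph W) : G.labelledCopyCount H = G.copyCount H * Nat.card (H ≃g H) := by
  classical
  have hfibre : ∀ c : H.Copy G,
      (Finset.univ.filter fun d : H.Copy G => d.toSubgraph = c.toSubgraph).card
        = Nat.card (H ≃g H) := by
    intro c
    rw [← Fintype.card_subtype, ← Nat.card_eq_fintype_card]
    refine (Nat.card_eq_of_bijective
      (fun σ : H ≃g H => (⟨c.comp σ.toCopy, toSubgraph_comp_iso c σ⟩ :
        {d : H.Copy G // d.toSubgraph = c.toSubgraph})) ⟨?_, ?_⟩).symm
    · intro σ τ hστ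
      exact RelIso.ext fun i =>
        c.injective (DFunLike.congr_fun (congrArg Subtype.val hστ) i)
    · rintro ⟨d, hd⟩
      obtain ⟨σ, hσ⟩ := exists_comp_iso_eq hd
      exact ⟨σ, Subtype.ext hσ⟩
  have hcard : G.labelledCopyCount H = (Finset.univ : Finset (H.Copy G)).card := by
    rw [SimpleGraph.labelledCopyCount, Finset.card_univ]
  rw [hcard, SimpleGraph.copyCount_eq_card_image_copyToSubgraph,
    Finset.card_eq_sum_card_image SimpleGraph.Copy.toSubgraph,
    Finset.sum_congr rfl (g := fun _ => Nat.card (H ≃g H)), Finset.sum_const, smul_eq_mul]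
  intro K hK
  obtain ⟨c, -, rfl⟩ := Finset.mem_image.1 hK
  exact hfibre c

theorem copyCount_congr {W' : Type*} {H' : SimpleGraph W'} [Fintype V] (e : H ≃g H') :
    G.copyCount H = G.copyCount H' := by
  classical
  unfold SimpleGraph.copyCount
  congr 1
  ext K
  simp only [Finset.mem_filter, Finset.mem_univ, true_and]
  exact ⟨fun ⟨i⟩ => ⟨e.symm.trans i⟩, fun ⟨i⟩ => ⟨e.trans i⟩⟩

/-- The graph on `Fin n` with the given edges. -/
abbrev patGraph {n : ℕ} (E : Finset (Sym2 (Fin n))) : SimpleGraph (Fin n) :=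
  SimpleGraph.fromEdgeSet E

/-- The number of automorphisms of the graph with edge set `E`. -/
def autCount {n : ℕ} (E : Finset (Sym2 (Fin n))) : ℕ :=
  (Finset.univ.filter fun σ : Equiv.Perm (Fin n) => mapEdges σ E = E).card

theorem mapEdges_subset_iff {n : ℕ} {E : Finset (Sym2 (Fin n))} (hE : ∀ e ∈ E, ¬ e.IsDiag)
    [DecidableEq V] {F : Finset (Sym2 V)} {f : Fin n → V} :
    mapEdges f E ⊆ F ↔ ∀ i j, (patGraph E).Adj i j → s(f i, f j) ∈ F := by
  simp only [mapEdges, Finset.image_subset_iff, Sym2.forall, Sym2.map_mk,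
    SimpleGraph.fromEdgeSet_adj, Finset.mem_coe]
  exact ⟨fun h i j hij => h i j hij.1, fun h i j hij => h i j ⟨hij, fun e => hE _ hij e⟩⟩

theorem card_iso_eq_autCount {n : ℕ} {E : Finset (Sym2 (Fin n))} (hE : ∀ e ∈ E, ¬ e.IsDiag) :
    Nat.card (patGraph E ≃g patGraph E) = autCount E := by
  have hadj : ∀ i j, (patGraph E).Adj i j ↔ s(i, j) ∈ E := by
    intro i j
    simp only [SimpleGraph.fromEdgeSet_adj, Finset.mem_coe, and_iff_left_iff_imp]
    exact fun hij e => hE _ hij e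
  have hiso : ∀ σ : Equiv.Perm (Fin n), mapEdges σ E = E ↔
      ∀ {i j}, (patGraph E).Adj (σ i) (σ j) ↔ (patGraph E).Adj i j := by
    intro σ
    simp only [hadj]
    constructor
    · intro h i j
      calc s(σ i, σ j) ∈ E ↔ Sym2.map σ s(i, j) ∈ mapEdges σ E := by rw [h, Sym2.map_mk]
        _ ↔ s(i, j) ∈ E := (Sym2.map.injective σ.injective).mem_finset_image
    · intro h
      refine Finset.eq_of_subset_of_card_le ((mapEdges_subset_iff hE).2 fun i j hij => ?_) ?_
      · exact h.2 ((hadj i j).1 hij)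
      · rw [mapEdges, Finset.card_image_of_injective _ (Sym2.map.injective σ.injective)]
  rw [autCount, ← Fintype.card_subtype, ← Nat.card_eq_fintype_card]
  exact Nat.card_congr
    { toFun := fun e => ⟨e.toEquiv, (hiso _).2 e.map_rel_iff⟩
      invFun := fun σ => ⟨σ.1, (hiso _).1 σ.2⟩
      left_inv := fun _ => rfl
      right_inv := fun _ => rfl }

variable [Fintype V] [DecidableEq V] [DecidableRel G.Adj]

theorem embSum_zero_eq_labelledCopyCount {n : ℕ} {E : Finset (Sym2 (Fin n))}
    (hE : ∀ e ∈ E, ¬ e.IsDiag) : embSum G E 0 = G.labelledCopyCount (patGraph E) := by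
  classical
  have hhom : ∀ f : Fin n → V, mapEdges f E ⊆ G.edgeFinset ↔
      ∀ i j, (patGraph E).Adj i j → G.Adj (f i) (f j) := by
    simp [mapEdges_subset_iff hE]
  have hcopies : {f : Fin n ↪ V // mapEdges f E ⊆ G.edgeFinset} ≃ (patGraph E).Copy G :=
    { toFun := fun f => ⟨⟨f.1, fun {i j} h => (hhom _).1 f.2 i j h⟩, f.1.injective⟩
      invFun := fun c => ⟨c.toEmbedding, (hhom _).2 fun i j h => c.toHom.map_adj h⟩
      left_inv := fun _ => rfl
      right_inv := fun _ => rfl }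
  have hcard : (Finset.univ.filter fun f : Fin n ↪ V => mapEdges f E ⊆ G.edgeFinset).card
      = G.labelledCopyCount (patGraph E) := by
    rw [← Fintype.card_subtype, SimpleGraph.labelledCopyCount]
    convert Fintype.card_congr hcopies
  simp [embSum_zero, edgeInd, hcard]

theorem embSum_zero_eq_copyCount_mul {n : ℕ} {E : Finset (Sym2 (Fin n))}
    (hE : ∀ e ∈ E, ¬ e.IsDiag) :
    embSum G E 0 = G.copyCount (patGraph E) * autCount E := by
  rw [embSum_zero_eq_labelledCopyCount hE, labelledCopyCount_eq_copyCount_mul,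
    card_iso_eq_autCount hE, Nat.cast_mul]

theorem pathGraph_two : SimpleGraph.pathGraph 2 = patGraph edgesL2 := by
  ext i j; revert i j; simp only [SimpleGraph.pathGraph_adj]; decide

theorem pathGraph_three : SimpleGraph.pathGraph 3 = patGraph edgesL3 := by
  ext i j; revert i j; simp only [SimpleGraph.pathGraph_adj]; decide

theorem pathGraph_four : SimpleGraph.pathGraph 4 = patGraph edgesL4 := by
  ext i j; revert i j; simp only [SimpleGraph.pathGraph_adj]; decide

theorem pathGraph_five : SimpleGraph.pathGraph 5 = patGraph edgesL5 := by
  ext i j; revert i j; simp only [SimpleGraph.pathGraph_adj]; decide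

theorem cycleGraph_four : SimpleGraph.cycleGraph 4 = patGraph edgesC4 := by
  ext i j; revert i j; decide

theorem pawGraph_eq : pawGraph = patGraph edgesPaw := by
  simp [pawGraph, patGraph]

/-- The disjoint union of a triangle and an edge, as a graph on `Fin 5`. -/
def triangleSumEdgeIso :
    SimpleGraph.cycleGraph 3 ⊕g SimpleGraph.pathGraph 2 ≃g patGraph edgesC3L2 where
  toEquiv := finSumFinEquiv
  map_rel_iff' := by
    rintro (i | i) (j | j)
    all_goals simp only [SimpleGraph.sum_adj, SimpleGraph.pathGraph_adj]; revert i j; decide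

theorem embSum_edgesL2 : embSum G edgesL2 0 = 2 * nL G 2 := by
  rw [embSum_zero_eq_copyCount_mul (by decide), ← pathGraph_two, nL,
    show autCount edgesL2 = 2 by decide +kernel]
  ring

theorem embSum_edgesL3 : embSum G edgesL3 0 = 2 * nL G 3 := by
  rw [embSum_zero_eq_copyCount_mul (by decide), ← pathGraph_three, nL,
    show autCount edgesL3 = 2 by decide +kernel]
  ring

theorem embSum_edgesL4 : embSum G edgesL4 0 = 2 * nL G 4 := by
  rw [embSum_zero_eq_copyCount_mul (by decide), ← pathGraph_four, nL,
    show autCount edgesL4 = 2 by decide +kernel]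
  ring

theorem embSum_edgesL5 : embSum G edgesL5 0 = 2 * nL G 5 := by
  rw [embSum_zero_eq_copyCount_mul (by decide), ← pathGraph_five, nL,
    show autCount edgesL5 = 2 by decide +kernel]
  ring

theorem embSum_edgesC4 : embSum G edgesC4 0 = 8 * nC4 G := by
  rw [embSum_zero_eq_copyCount_mul (by decide), ← cycleGraph_four, nC4,
    show autCount edgesC4 = 8 by decide +kernel]
  ring

theorem embSum_edgesPaw : embSum G edgesPaw 0 = 2 * nPaw G := by
  rw [embSum_zero_eq_copyCount_mul (by decide), ← pawGraph_eq, nPaw,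
    show autCount edgesPaw = 2 by decide +kernel]
  ring

theorem embSum_edgesC3L2 : embSum G edgesC3L2 0 = 12 * nC3L2 G := by
  rw [embSum_zero_eq_copyCount_mul (by decide), ← copyCount_congr triangleSumEdgeIso, nC3L2,
    show autCount edgesC3L2 = 12 by decide +kernel]
  ring

end CopyCount

section Quadruples

variable {V : Type*} [Fintype V]

theorem sum_eq_sum_embedding (g : V → ℝ) : ∑ v, g v = ∑ f : Fin 1 ↪ V, g (f 0) := by
  simpa using sum_embedding_sum (n := 0) fun _ w => g w

variable [DecidableEq V]

theorem sum_nodup_eq_sum_embedding (F : V → V → V → V → ℝ) :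
    ∑ s, ∑ t, ∑ u, ∑ v, (if [s, t, u, v].Nodup then F s t u v else 0)
      = ∑ f : Fin 4 ↪ V, F (f 0) (f 1) (f 2) (f 3) := by
  have hfilter : ∑ s, ∑ t, ∑ u, ∑ v, (if [s, t, u, v].Nodup then F s t u v else 0)
      = ∑ x : V × V × V × V with [x.1, x.2.1, x.2.2.1, x.2.2.2].Nodup,
        F x.1 x.2.1 x.2.2.1 x.2.2.2 := by
    simp only [Finset.sum_filter, Fintype.sum_prod_type]
  rw [hfilter]
  symm
  refine Finset.sum_bij (fun f _ => (f 0, f 1, f 2, f 3)) ?_ ?_ ?_ fun _ _ => rfl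
  · intro f _
    exact Finset.mem_filter.2 ⟨Finset.mem_univ _, (List.nodup_ofFn (f := f)).2 f.injective⟩
  · intro f _ g _ h
    simp only [Prod.mk.injEq] at h
    ext i
    fin_cases i
    exacts [h.1, h.2.1, h.2.2.1, h.2.2.2]
  · rintro ⟨s, t, u, v⟩ h
    have hinj : Function.Injective ![s, t, u, v] :=
      (List.nodup_ofFn (f := ![s, t, u, v])).1 (Finset.mem_filter.1 h).2
    exact ⟨⟨![s, t, u, v], hinj⟩, Finset.mem_univ _, rfl⟩

variable (G : SimpleGraph V) [DecidableRel G.Adj]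

theorem sumQ_eq_sum (F : V → V → V → V → ℝ) : sumQ G F = (1 / 8) * ∑ s, ∑ t, ∑ u, ∑ v,
    if ({s(s, t), s(u, v)} : Finset (Sym2 V)) ∈ indepPairs G then F s t u v else 0 := by
  rw [sumQ, ← Finset.mul_sum, Finset.sum_comm]
  congr 1
  refine Finset.sum_congr rfl fun s _ => ?_
  rw [Finset.sum_comm]
  refine Finset.sum_congr rfl fun t _ => ?_
  rw [Finset.sum_comm]
  refine Finset.sum_congr rfl fun u _ => ?_
  rw [Finset.sum_comm]
  refine Finset.sum_congr rfl fun v _ => ?_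
  simp only [Finset.sum_ite_eq']

theorem sumQ_eq_sum_embedding (F : V → V → V → V → ℝ) : sumQ G F = (1 / 8) *
    ∑ f : Fin 4 ↪ V, F (f 0) (f 1) (f 2) (f 3) * edgeInd G edges2L2 f := by
  have hInd : ∀ s t u v, edgeInd G edges2L2 ![s, t, u, v] = a G s t * a G u v := by
    intro s t u v
    rw [edges2L2, ← insert_empty_eq s((2 : Fin 4), 3), edgeInd_insert, edgeInd_insert,
      edgeInd_empty, mul_one]
    rfl
  have hvec : ∀ f : Fin 4 ↪ V, ![f 0, f 1, f 2, f 3] = f := fun f => List.ofFn_injective rfl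
  have hterm : ∀ s t u v,
      (if ({s(s, t), s(u, v)} : Finset (Sym2 V)) ∈ indepPairs G then F s t u v else 0)
        = if [s, t, u, v].Nodup then F s t u v * edgeInd G edges2L2 ![s, t, u, v] else 0 := by
    intro s t u v
    rw [hInd, a_eq, a_eq]
    by_cases hst : G.Adj s t <;> by_cases huv : G.Adj u v <;>
      simp [pair_mem_indepPairs, hst, huv]
  simp only [sumQ_eq_sum, hterm, sum_nodup_eq_sum_embedding, hvec]

/-- An edge pair can be written as `{st, uv}` in eight ways, so that sums over `Q` of symmetrized
functions are sums over ordered quadruples. -/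
theorem mul_sumQ_eq_sum_embedding (c : ℝ) {F F' : V → V → V → V → ℝ}
    (hF : ∀ s t u v, c * F s t u v = F' s t u v + F' s t v u + F' t s u v + F' t s v u
      + F' u v s t + F' u v t s + F' v u s t + F' v u t s) :
    c * sumQ G F = ∑ f : Fin 4 ↪ V, F' (f 0) (f 1) (f 2) (f 3) * edgeInd G edges2L2 f := by
  have hperm : ∀ i j k l : Fin 4, Function.Injective ![i, j, k, l] →
      mapEdges ![i, j, k, l] edges2L2 = edges2L2 →
      ∑ f : Fin 4 ↪ V, F' (f i) (f j) (f k) (f l) * edgeInd G edges2L2 f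
        = ∑ f : Fin 4 ↪ V, F' (f 0) (f 1) (f 2) (f 3) * edgeInd G edges2L2 f := by
    intro i j k l hinj hE
    rw [← sum_embedding_comp _ hinj fun f =>
      F' (f 0) (f 1) (f 2) (f 3) * edgeInd G edges2L2 f]
    simp only [← edgeInd_mapEdges, hE, Function.comp_apply, Matrix.cons_val]
  rw [sumQ_eq_sum_embedding, mul_left_comm, Finset.mul_sum]
  simp only [← mul_assoc, hF, add_mul, Finset.sum_add_distrib]
  linear_combination (1 / 8) * (hperm 0 1 3 2 (by decide) (by decide)
    + hperm 1 0 2 3 (by decide) (by decide) + hperm 1 0 3 2 (by decide) (by decide)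
    + hperm 2 3 0 1 (by decide) (by decide) + hperm 2 3 1 0 (by decide) (by decide)
    + hperm 3 2 0 1 (by decide) (by decide) + hperm 3 2 1 0 (by decide) (by decide))

end Quadruples

section DegreeExpansions

variable {V : Type*} [Fintype V] [DecidableEq V] (G : SimpleGraph V) [DecidableRel G.Adj]

theorem embSum_edgesL2_deg : embSum G edgesL2 {0}
    = embSum G edgesL2 0 + embSum G edgesL3 0 := by
  rw [embSum_singleton, Fin.sum_univ_two,
    embSum_of_diag_mem (E := insert s(0, 0) _) 0,
    embSum_zero_reindex (E := insert s(0, 1) _) (E' := edgesL2) ![0, 1],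
    embSum_zero_reindex (E := insert s(_, 0) (mapEdges _ _)) (E' := edgesL3) ![0, 1, 2]]
  ring

theorem embSum_edgesL2_deg_new : embSum G (mapEdges Fin.succ edgesL2) {0}
    = 2 * embSum G edgesL3 0 + embSum G edges2L2 0 := by
  rw [embSum_singleton, Fin.sum_univ_three,
    embSum_of_diag_mem (E := insert s(0, 0) _) 0,
    embSum_zero_reindex (E := insert s(0, 1) _) (E' := edgesL3) ![0, 1, 2],
    embSum_zero_reindex (E := insert s(0, 2) _) (E' := edgesL3) ![0, 2, 1],
    embSum_zero_reindex (E := insert s(_, 0) (mapEdges _ _)) (E' := edges2L2) ![0, 1, 2, 3]]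
  ring

theorem embSum_edges2L2_deg : embSum G edges2L2 {0}
    = embSum G edges2L2 0 + 2 * embSum G edgesL4 0 + embSum G edgesL2L3 0 := by
  rw [embSum_singleton, Fin.sum_univ_four,
    embSum_of_diag_mem (E := insert s(0, 0) _) 0,
    embSum_zero_reindex (E := insert s(0, 1) _) (E' := edges2L2) ![0, 1, 2, 3],
    embSum_zero_reindex (E := insert s(0, 2) _) (E' := edgesL4) ![1, 0, 2, 3],
    embSum_zero_reindex (E := insert s(0, 3) _) (E' := edgesL4) ![1, 0, 3, 2],
    embSum_zero_reindex (E := insert s(_, 0) (mapEdges _ _)) (E' := edgesL2L3) ![3, 2, 4, 0, 1]]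
  ring

theorem embSum_edges2L2_deg_new : embSum G (mapEdges Fin.succ edges2L2) {0}
    = 4 * embSum G edgesL2L3 0 + embSum G edges3L2 0 := by
  rw [embSum_singleton, Fin.sum_univ_five,
    embSum_of_diag_mem (E := insert s(0, 0) _) 0,
    embSum_zero_reindex (E := insert s(0, 1) _) (E' := edgesL2L3) ![3, 2, 4, 0, 1],
    embSum_zero_reindex (E := insert s(0, 2) _) (E' := edgesL2L3) ![3, 4, 2, 0, 1],
    embSum_zero_reindex (E := insert s(0, 3) _) (E' := edgesL2L3) ![3, 0, 1, 2, 4],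
    embSum_zero_reindex (E := insert s(0, 4) _) (E' := edgesL2L3) ![3, 0, 1, 4, 2],
    embSum_zero_reindex (E := insert s(_, 0) (mapEdges _ _)) (E' := edges3L2) ![0, 1, 2, 3, 4, 5]]
  ring

theorem embSum_edgesL4_deg_end : embSum G edgesL4 {0}
    = embSum G edgesL4 0 + embSum G edgesPaw 0 + embSum G edgesC4 0 + embSum G edgesL5 0 := by
  rw [embSum_singleton, Fin.sum_univ_four,
    embSum_of_diag_mem (E := insert s(0, 0) _) 0,
    embSum_zero_reindex (E := insert s(0, 1) _) (E' := edgesL4) ![0, 1, 2, 3],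
    embSum_zero_reindex (E := insert s(0, 2) _) (E' := edgesPaw) ![0, 1, 2, 3],
    embSum_zero_reindex (E := insert s(0, 3) _) (E' := edgesC4) ![0, 1, 2, 3],
    embSum_zero_reindex (E := insert s(_, 0) (mapEdges _ _)) (E' := edgesL5) ![0, 1, 2, 3, 4]]
  ring

theorem embSum_edgesL4_deg_inner : embSum G edgesL4 {1}
    = 2 * embSum G edgesL4 0 + embSum G edgesPaw 0 + embSum G edgesFork 0 := by
  rw [embSum_singleton, Fin.sum_univ_four,
    embSum_zero_reindex (E := insert s(1, 0) _) (E' := edgesL4) ![0, 1, 2, 3],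
    embSum_of_diag_mem (E := insert s(1, 1) _) 1,
    embSum_zero_reindex (E := insert s(1, 2) _) (E' := edgesL4) ![0, 1, 2, 3],
    embSum_zero_reindex (E := insert s(1, 3) _) (E' := edgesPaw) ![3, 2, 0, 1],
    embSum_zero_reindex (E := insert s(_, 0) (mapEdges _ _)) (E' := edgesFork) ![0, 4, 1, 2, 3]]
  ring

theorem embSum_edgesL4_deg_new : embSum G (mapEdges Fin.succ edgesL4) {0}
    = 2 * embSum G edgesL5 0 + 2 * embSum G edgesFork 0 + embSum G edgesL4L2 0 := by
  rw [embSum_singleton, Fin.sum_univ_five,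
    embSum_of_diag_mem (E := insert s(0, 0) _) 0,
    embSum_zero_reindex (E := insert s(0, 1) _) (E' := edgesL5) ![0, 1, 2, 3, 4],
    embSum_zero_reindex (E := insert s(0, 2) _) (E' := edgesFork) ![0, 4, 1, 2, 3],
    embSum_zero_reindex (E := insert s(0, 3) _) (E' := edgesFork) ![0, 3, 2, 1, 4],
    embSum_zero_reindex (E := insert s(0, 4) _) (E' := edgesL5) ![0, 4, 3, 2, 1],
    embSum_zero_reindex (E := insert s(_, 0) (mapEdges _ _)) (E' := edgesL4L2) ![4, 5, 1, 0, 2, 3]]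
  ring

theorem embSum_edgesL2L3_deg_edge : embSum G edgesL2L3 {0}
    = embSum G edgesL2L3 0 + embSum G edgesFork 0 + 2 * embSum G edgesL5 0
      + embSum G edges2L3 0 := by
  rw [embSum_singleton, Fin.sum_univ_five,
    embSum_of_diag_mem (E := insert s(0, 0) _) 0,
    embSum_zero_reindex (E := insert s(0, 1) _) (E' := edgesL2L3) ![0, 1, 2, 3, 4],
    embSum_zero_reindex (E := insert s(0, 2) _) (E' := edgesFork) ![2, 3, 1, 0, 4],
    embSum_zero_reindex (E := insert s(0, 3) _) (E' := edgesL5) ![1, 0, 3, 2, 4],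
    embSum_zero_reindex (E := insert s(0, 4) _) (E' := edgesL5) ![1, 0, 3, 4, 2],
    embSum_zero_reindex (E := insert s(_, 0) (mapEdges _ _)) (E' := edges2L3) ![1, 0, 4, 2, 3, 5]]
  ring

theorem embSum_edgesL2L3_deg_leaf : embSum G edgesL2L3 {3}
    = 2 * embSum G edgesL5 0 + embSum G edgesL2L3 0 + embSum G edgesC3L2 0
      + embSum G edgesL4L2 0 := by
  rw [embSum_singleton, Fin.sum_univ_five,
    embSum_zero_reindex (E := insert s(3, 0) _) (E' := edgesL5) ![1, 0, 3, 2, 4],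
    embSum_zero_reindex (E := insert s(3, 1) _) (E' := edgesL5) ![0, 1, 3, 2, 4],
    embSum_zero_reindex (E := insert s(3, 2) _) (E' := edgesL2L3) ![0, 1, 2, 3, 4],
    embSum_of_diag_mem (E := insert s(3, 3) _) 3,
    embSum_zero_reindex (E := insert s(3, 4) _) (E' := edgesC3L2) ![3, 4, 0, 1, 2],
    embSum_zero_reindex (E := insert s(_, 0) (mapEdges _ _)) (E' := edgesL4L2) ![1, 4, 5, 2, 0, 3]]
  ring

theorem embSum_edges2L2_deg_deg_same : embSum G edges2L2 {0, 1}
    = embSum G edges2L2 {0} + 2 * embSum G edgesL4 {0} + embSum G edgesL2L3 {3} := by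
  rw [embSum_pair, Fin.sum_univ_four,
    embSum_of_diag_mem (E := insert s(0, 0) _) 0,
    embSum_reindex (E := insert s(0, 1) _) (E' := edges2L2) (D' := {0}) ![1, 0, 2, 3],
    embSum_reindex (E := insert s(0, 2) _) (E' := edgesL4) (D' := {0}) ![1, 0, 2, 3],
    embSum_reindex (E := insert s(0, 3) _) (E' := edgesL4) (D' := {0}) ![1, 0, 3, 2],
    embSum_reindex (E := insert s(_, 0) (mapEdges _ _))
      (E' := edgesL2L3) (D' := {3}) ![4, 2, 3, 0, 1]]
  ring

theorem embSum_edges2L2_deg_deg_distinct : embSum G edges2L2 {0, 2}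
    = embSum G edges2L2 {0} + embSum G edgesL4 {1} + embSum G edgesL4 {0}
      + embSum G edgesL2L3 {0} := by
  rw [embSum_pair, Fin.sum_univ_four,
    embSum_of_diag_mem (E := insert s(0, 0) _) 0,
    embSum_reindex (E := insert s(0, 1) _) (E' := edges2L2) (D' := {0}) ![2, 3, 0, 1],
    embSum_reindex (E := insert s(0, 2) _) (E' := edgesL4) (D' := {1}) ![2, 3, 1, 0],
    embSum_reindex (E := insert s(0, 3) _) (E' := edgesL4) (D' := {0}) ![2, 3, 0, 1],
    embSum_reindex (E := insert s(_, 0) (mapEdges _ _))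
      (E' := edgesL2L3) (D' := {0}) ![3, 2, 4, 0, 1]]
  ring

theorem sum_embSum_edges2L2_deg : ∑ j, embSum G edges2L2 {j} = 4 * embSum G edges2L2 {0} := by
  rw [Fin.sum_univ_four,
    embSum_reindex (E := edges2L2) (D := {1}) (E' := edges2L2) (D' := {0}) ![1, 0, 2, 3],
    embSum_reindex (E := edges2L2) (D := {2}) (E' := edges2L2) (D' := {0}) ![2, 3, 0, 1],
    embSum_reindex (E := edges2L2) (D := {3}) (E' := edges2L2) (D' := {0}) ![3, 2, 1, 0]]
  ring

theorem sum_embSum_edgesL4_deg :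
    ∑ j, embSum G edgesL4 {j} = 2 * embSum G edgesL4 {0} + 2 * embSum G edgesL4 {1} := by
  rw [Fin.sum_univ_four,
    embSum_reindex (E := edgesL4) (D := {2}) (E' := edgesL4) (D' := {1}) ![3, 2, 1, 0],
    embSum_reindex (E := edgesL4) (D := {3}) (E' := edgesL4) (D' := {0}) ![3, 2, 1, 0]]
  ring

end DegreeExpansions

section Identities

variable {V : Type*} [Fintype V] [DecidableEq V] (G : SimpleGraph V) [DecidableRel G.Adj]

variable {G} in
theorem typeOf_self {p : Finset (Sym2 V)} (hp : p ∈ indepPairs G) : typeOf p p = t24 := by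
  have hcard : p.card = 2 := (Finset.mem_powersetCard.1 (Finset.mem_filter.1 hp).1).2
  simp [typeOf, hcard]

variable {G} in
theorem eq_of_typeOf_eq_t24 {p r : Finset (Sym2 V)} (hp : p ∈ indepPairs G)
    (hr : r ∈ indepPairs G) (ht : typeOf p r = t24) : p = r := by
  rcases ht ▸ isPattern_typeOf (mem_indepPairs_iff_subset.1 hp).1
    (mem_indepPairs_iff_subset.1 hr).1 with ⟨f, -, rfl, rfl⟩ | ⟨f, -, rfl, rfl⟩ <;> rfl

theorem freq_t24 : freq G t24 = q G := by
  have hdiag : (indepPairs G ×ˢ indepPairs G).filter (fun x => typeOf x.1 x.2 = t24)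
      = (indepPairs G).diag := by
    ext ⟨p, r⟩
    simp only [Finset.mem_filter, Finset.mem_product, Finset.mem_diag]
    refine ⟨fun h => ⟨h.1.1, eq_of_typeOf_eq_t24 h.1.1 h.1.2 h.2⟩, ?_⟩
    rintro ⟨hp, rfl⟩
    exact ⟨⟨hp, hp⟩, typeOf_self hp⟩
  rw [freq, hdiag, Finset.diag_card, q]

theorem eight_mul_q : 8 * q G = embSum G edges2L2 0 := by
  have hpattern : embSum G (patFst t24 ∪ patSnd t24) 0 = embSum G edges2L2 0 :=
    embSum_zero_reindex (n := 4) ![0, 1, 2, 3]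
  have hcount := patSymm_mul_freq G t24
  rw [patSymm_t24, freq_t24, hpattern] at hcount
  push_cast at hcount
  linarith

theorem two_mul_freq_t13 : 2 * freq G t13 = embSum G edgesL2L3 0 := by
  have hpattern : embSum G (patFst t13 ∪ patSnd t13) 0 = embSum G edgesL2L3 0 :=
    embSum_zero_reindex (n := 5) ![0, 1, 2, 3, 4]
  have hcount := patSymm_mul_freq G t13
  rw [patSymm_t13, hpattern] at hcount
  push_cast at hcount
  linarith

theorem eight_mul_freq_t12 : 8 * freq G t12 = embSum G edges3L2 0 := by
  have hpattern : embSum G (patFst t12 ∪ patSnd t12) 0 = embSum G edges3L2 0 :=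
    embSum_zero_reindex (n := 6) ![0, 1, 2, 3, 4, 5]
  have hcount := patSymm_mul_freq G t12
  rw [patSymm_t12, hpattern] at hcount
  push_cast at hcount
  linarith

theorem four_mul_freq_t04 : 4 * freq G t04 = embSum G edgesC4 0 := by
  have hpattern : embSum G (patFst t04 ∪ patSnd t04) 0 = embSum G edgesC4 0 :=
    embSum_zero_reindex (n := 4) ![0, 1, 3, 2]
  have hcount := patSymm_mul_freq G t04
  rw [patSymm_t04, hpattern] at hcount
  push_cast at hcount
  linarith

theorem freq_t03_eq_embSum : freq G t03 = embSum G edgesL5 0 := by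
  have hpattern : embSum G (patFst t03 ∪ patSnd t03) 0 = embSum G edgesL5 0 :=
    embSum_zero_reindex (n := 5) ![1, 0, 2, 3, 4]
  have hcount := patSymm_mul_freq G t03
  rw [patSymm_t03, hpattern] at hcount
  push_cast at hcount
  linarith

theorem two_mul_freq_t021 : 2 * freq G t021 = embSum G edgesL4L2 0 := by
  have hpattern : embSum G (patFst t021 ∪ patSnd t021) 0 = embSum G edgesL4L2 0 :=
    embSum_zero_reindex (n := 6) ![0, 1, 2, 3, 4, 5]
  have hcount := patSymm_mul_freq G t021
  rw [patSymm_t021, hpattern] at hcount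
  push_cast at hcount
  linarith

theorem two_mul_freq_t022 : 2 * freq G t022 = embSum G edges2L3 0 := by
  have hpattern : embSum G (patFst t022 ∪ patSnd t022) 0 = embSum G edges2L3 0 :=
    embSum_zero_reindex (n := 6) ![0, 1, 2, 3, 4, 5]
  have hcount := patSymm_mul_freq G t022
  rw [patSymm_t022, hpattern] at hcount
  push_cast at hcount
  linarith

theorem two_mul_K : 2 * K G = embSum G edges2L2 {0} := by
  rw [K, mul_sumQ_eq_sum_embedding G 2 (F' := fun s _ _ _ => k G s) fun s t u v => by ring]
  simp [embSum]

theorem four_mul_Phi1 : 4 * Phi1 G = embSum G edges2L2 {0, 1} := by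
  rw [Phi1, mul_sumQ_eq_sum_embedding G 4 (F' := fun s t _ _ => k G s * k G t)
    fun s t u v => by ring]
  simp [embSum]

theorem two_mul_Phi2 : 2 * Phi2 G = embSum G edges2L2 {0, 2} := by
  rw [Phi2, mul_sumQ_eq_sum_embedding G 2 (F' := fun s _ u _ => k G s * k G u)
    fun s t u v => by ring]
  simp [embSum]

theorem Lambda1_eq : Lambda1 G = embSum G edgesL4 {0} := by
  rw [Lambda1, ← one_mul (sumQ _ _), mul_sumQ_eq_sum_embedding G 1
      (F' := fun s t u _ => k G s * a G t u)
      fun s t u v => by rw [a_comm u t, a_comm v t, a_comm u s, a_comm v s]; ring,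
    ← embSum_reindex (E := insert s(1, 2) edges2L2) (D := {0}) ![0, 1, 2, 3]]
  simp [embSum, edgeInd_insert, mul_assoc]

theorem Lambda2_eq : Lambda2 G = embSum G edgesL4 {0} + embSum G edgesL4 {1} := by
  have hsum : 2 * Lambda2 G = ∑ j, embSum G (insert s(1, 2) edges2L2) {j} := by
    rw [Lambda2, mul_sumQ_eq_sum_embedding G 2
      (F' := fun s t u v => a G t u * (k G s + k G t + k G u + k G v))
      fun s t u v => by rw [a_comm u t, a_comm v t, a_comm u s, a_comm v s]; ring]
    simp only [embSum, edgeInd_insert, Fin.sum_univ_four, ← Finset.sum_add_distrib,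
      Multiset.map_singleton, Multiset.prod_singleton]
    exact Finset.sum_congr rfl fun f _ => by ring
  have hpath : insert s(1, 2) edges2L2 = edgesL4 := by decide
  rw [hpath, sum_embSum_edgesL4_deg] at hsum
  linarith

theorem sum_degree : ∑ v, k G v = embSum G edgesL2 0 := by
  have hsum : ∑ v, k G v = embSum G (∅ : Finset (Sym2 (Fin 1))) {0} := by
    rw [sum_eq_sum_embedding]
    simp [embSum, edgeInd_empty]
  rw [hsum, embSum_singleton, Fin.sum_univ_one, embSum_of_diag_mem (E := insert s(0, 0) _) 0,
    embSum_zero_reindex (E := insert s(_, 0) (mapEdges _ _)) (E' := edgesL2) ![0, 1], zero_add]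

theorem sum_degree_sq : ∑ v, k G v ^ 2 = embSum G edgesL2 0 + embSum G edgesL3 0 := by
  have hsum : ∑ v, k G v ^ 2 = embSum G (∅ : Finset (Sym2 (Fin 1))) {0, 0} := by
    rw [sum_eq_sum_embedding]
    simp [embSum, edgeInd_empty, sq]
  rw [hsum, embSum_pair, Fin.sum_univ_one, embSum_of_diag_mem (E := insert s(0, 0) _) 0,
    embSum_reindex (E := insert s(_, 0) (mapEdges _ _)) (E' := edgesL2) (D' := {0}) ![1, 0],
    zero_add, embSum_edgesL2_deg]

theorem two_mul_m_eq : 2 * m G = embSum G edgesL2 0 := by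
  rw [two_mul_m, sum_degree]

theorem four_mul_m_sq : 4 * m G ^ 2
    = 2 * embSum G edgesL2 0 + 4 * embSum G edgesL3 0 + embSum G edges2L2 0 := by
  have hprod := two_mul_m_mul_embSum (G := G) edgesL2
  rw [Fin.sum_univ_two,
    embSum_reindex (E := edgesL2) (D := {1}) (E' := edgesL2) (D' := {0}) ![1, 0],
    embSum_edgesL2_deg, embSum_edgesL2_deg_new, ← two_mul_m_eq] at hprod
  rw [← two_mul_m_eq]
  linarith

theorem two_mul_m_mul_embSum_edges2L2 : 2 * m G * embSum G edges2L2 0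
    = 4 * embSum G edges2L2 {0} + 4 * embSum G edgesL2L3 0 + embSum G edges3L2 0 := by
  rw [two_mul_m_mul_embSum, sum_embSum_edges2L2_deg, embSum_edges2L2_deg_new]
  ring

theorem two_mul_m_mul_embSum_edgesL4 : 2 * m G * embSum G edgesL4 0
    = 2 * embSum G edgesL4 {0} + 2 * embSum G edgesL4 {1} + 2 * embSum G edgesL5 0
      + 2 * embSum G edgesFork 0 + embSum G edgesL4L2 0 := by
  rw [two_mul_m_mul_embSum, sum_embSum_edgesL4_deg, embSum_edgesL4_deg_new]
  ring

end Identities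

section Trace

variable {V : Type*} [DecidableEq V] (G : SimpleGraph V) [DecidableRel G.Adj]

/-- A closed walk `s t u v` that is not a cycle has `u = s` or `v = t`. -/
theorem a_mul_a_mul_a_mul_a (s t u v : V) : a G s t * a G t u * a G u v * a G v s
    = (if u = s then a G s t * a G s v else 0) + (if v = t then a G t s * a G t u else 0)
      - (if u = s then if v = t then a G s t else 0 else 0)
      + (if [s, t, u, v].Nodup then a G s t * a G t u * a G u v * a G v s else 0) := by
  have hsq : ∀ x y, a G x y * a G x y = a G x y := fun x y => by rw [a_eq]; split_ifs <;> simp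
  have hself : ∀ x, a G x x = 0 := fun x => by simp [a_eq]
  rcases eq_or_ne u s with rfl | hus <;> rcases eq_or_ne v t with rfl | hvt
  · simp [a_comm v u, hsq]
  · simp [a_comm v u, a_comm t u, hsq, hvt, mul_assoc]
  · have hnodup : ¬ [s, v, u, v].Nodup := by simp
    rw [if_neg hus, if_pos rfl, if_neg hus, if_neg hnodup, a_comm s v, a_comm u v]
    linear_combination a G v s * a G v s * hsq v u + a G v u * hsq v s
  · rw [if_neg hus, if_neg hvt, if_neg hus]
    by_cases hnodup : [s, t, u, v].Nodup
    · simp [hnodup]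
    · have hloop : s = t ∨ t = u ∨ u = v ∨ v = s := by
        contrapose! hnodup
        simp [hnodup.1, hnodup.2.1, hnodup.2.2.1, hnodup.2.2.2.symm, hus.symm, hvt.symm]
      rcases hloop with rfl | rfl | rfl | rfl <;> simp [hself, hnodup]

variable [Fintype V]

theorem trace_adjMatrix_pow_four_eq_sum : (G.adjMatrix ℝ ^ 4).trace
    = ∑ s, ∑ t, ∑ u, ∑ v, a G s t * a G t u * a G u v * a G v s := by
  have hpow : G.adjMatrix ℝ ^ 4
      = G.adjMatrix ℝ * (G.adjMatrix ℝ * (G.adjMatrix ℝ * G.adjMatrix ℝ)) := by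
    simp only [pow_succ, pow_zero, one_mul, mul_assoc]
  simp only [hpow, Matrix.trace, Matrix.diag, Matrix.mul_apply, Finset.mul_sum, a, mul_assoc]

theorem trace_adjMatrix_pow_four : (G.adjMatrix ℝ ^ 4).trace
    = embSum G edgesL2 0 + 2 * embSum G edgesL3 0 + embSum G edgesC4 0 := by
  have hsq : ∀ v, ∑ x, ∑ y, a G v x * a G v y = k G v ^ 2 := fun v => by
    rw [k_eq_sum, sq, Finset.sum_mul_sum]
  have hcycle : ∑ f : Fin 4 ↪ V,
      a G (f 0) (f 1) * a G (f 1) (f 2) * a G (f 2) (f 3) * a G (f 3) (f 0)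
      = embSum G edgesC4 0 := by
    rw [embSum_zero]
    refine Finset.sum_congr rfl fun f _ => ?_
    rw [edgesC4, ← insert_empty_eq s((3 : Fin 4), 0)]
    simp only [edgeInd_insert, edgeInd_empty, mul_one, mul_assoc]
  calc (G.adjMatrix ℝ ^ 4).trace
      = ∑ s, ∑ t, ∑ u, ∑ v, ((if u = s then a G s t * a G s v else 0)
          + (if v = t then a G t s * a G t u else 0)
          - (if u = s then if v = t then a G s t else 0 else 0)
          + (if [s, t, u, v].Nodup then a G s t * a G t u * a G u v * a G v s else 0)) := by
        rw [trace_adjMatrix_pow_four_eq_sum]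
        exact Fintype.sum_congr _ _ fun s => Fintype.sum_congr _ _ fun t =>
          Fintype.sum_congr _ _ fun u => Fintype.sum_congr _ _ fun v =>
            a_mul_a_mul_a_mul_a G s t u v
    _ = ∑ s, (∑ t, ∑ v, a G s t * a G s v) + ∑ s, ∑ t, ∑ u, a G t s * a G t u
          - ∑ s, ∑ t, a G s t + embSum G edgesC4 0 := by
        simp only [Finset.sum_add_distrib, Finset.sum_sub_distrib, sum_nodup_eq_sum_embedding
          fun s t u v => a G s t * a G t u * a G u v * a G v s, hcycle]
        simp [Finset.sum_ite_irrel]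
    _ = 2 * ∑ v, k G v ^ 2 - ∑ v, k G v + embSum G edgesC4 0 := by
        rw [Finset.sum_comm (f := fun s t => ∑ u, a G t s * a G t u)]
        simp only [hsq, ← k_eq_sum]
        ring
    _ = embSum G edgesL2 0 + 2 * embSum G edgesL3 0 + embSum G edgesC4 0 := by
        rw [sum_degree_sq, sum_degree]
        ring

end Trace

section Frequencies

variable {V : Type*} [Fintype V] [DecidableEq V] (G : SimpleGraph V) [DecidableRel G.Adj]

theorem freq_t13 : freq G t13 = K G - 4 * q G - 2 * nL G 4 := by
  linarith [two_mul_freq_t13 G, two_mul_K G, embSum_edges2L2_deg G, eight_mul_q G,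
    embSum_edgesL4 (G := G)]

theorem freq_t12 : freq G t12 = 2 * ((m G + 2) * q G + nL G 4 - K G) := by
  have hprod := two_mul_m_mul_embSum_edges2L2 G
  rw [← two_mul_K, ← two_mul_freq_t13, ← eight_mul_q, ← eight_mul_freq_t12, freq_t13] at hprod
  linarith

theorem freq_t04 : freq G t04 = 2 * nC4 G := by
  linarith [four_mul_freq_t04 G, embSum_edgesC4 (G := G)]

theorem freq_t04_eq_trace : freq G t04
    = (1 / 4) * (G.adjMatrix ℝ ^ 4).trace - nL G 3 - (1 / 2) * nL G 2 := by
  rw [trace_adjMatrix_pow_four, ← four_mul_freq_t04, embSum_edgesL2, embSum_edgesL3]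
  ring

theorem freq_t04_eq_trace_add_q_sub_m_sq : freq G t04
    = (1 / 4) * (G.adjMatrix ℝ ^ 4).trace + q G - (1 / 2) * m G ^ 2 := by
  linarith [trace_adjMatrix_pow_four G, four_mul_freq_t04 G, four_mul_m_sq G, eight_mul_q G]

theorem freq_t03 : freq G t03 = Lambda1 G - 2 * nL G 4 - 8 * nC4 G - 2 * nPaw G := by
  rw [freq_t03_eq_embSum, Lambda1_eq, embSum_edgesL4_deg_end, embSum_edgesC4, embSum_edgesL4,
    embSum_edgesPaw]
  ring

theorem freq_t021 : freq G t021 = 2 * q G + (m G + 5) * nL G 4 + 8 * nC4 G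
    + 3 * nPaw G + Phi1 G - 3 * nC3L2 G - Lambda1 G - Lambda2 G - K G := by
  have hprod := two_mul_m_mul_embSum_edgesL4 G
  have hPhi1 := four_mul_Phi1 G
  rw [embSum_edgesL4] at hprod
  rw [embSum_edges2L2_deg_deg_same, embSum_edgesL2L3_deg_leaf] at hPhi1
  linarith [two_mul_freq_t021 G, Lambda1_eq G, Lambda2_eq G, two_mul_K G, eight_mul_q G,
    embSum_edges2L2_deg G, embSum_edgesL4_deg_inner G, embSum_edgesL4_deg_end G,
    embSum_edgesL4 (G := G), embSum_edgesC4 (G := G), embSum_edgesPaw (G := G),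
    embSum_edgesC3L2 (G := G)]

theorem freq_t022 : freq G t022 = 4 * q G + 5 * nL G 4 + 2 * nPaw G + 4 * nC4 G
    + Phi2 G - Lambda2 G - 2 * K G - nL G 5 := by
  have hPhi2 := two_mul_Phi2 G
  rw [embSum_edges2L2_deg_deg_distinct, embSum_edgesL2L3_deg_edge] at hPhi2
  linarith [two_mul_freq_t022 G, Lambda1_eq G, Lambda2_eq G, two_mul_K G, eight_mul_q G,
    embSum_edges2L2_deg G, embSum_edgesL4_deg_inner G, embSum_edgesL4_deg_end G,
    embSum_edgesL4 (G := G), embSum_edgesL5 (G := G), embSum_edgesC4 (G := G),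
    embSum_edgesPaw (G := G)]

end Frequencies

section Forests

theorem not_isAcyclic_of_triangle {W : Type*} {H : SimpleGraph W} {x y z : W} (hxy : H.Adj x y)
    (hyz : H.Adj y z) (hzx : H.Adj z x) : ¬ H.IsAcyclic := fun h =>
  h (.cons hxy (.cons hyz (.cons hzx .nil)))
    (by simp [SimpleGraph.Walk.isCycle_def, SimpleGraph.Walk.isTrail_def, hxy.ne, hyz.ne, hzx.ne,
      hxy.ne', hzx.ne'])

variable {V W : Type*} [Fintype V] {G : SimpleGraph V} {H : SimpleGraph W}

theorem copyCount_eq_zero_of_isAcyclic (hG : G.IsAcyclic) (hH : ¬ H.IsAcyclic) :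
    G.copyCount H = 0 := by
  rw [SimpleGraph.copyCount_eq_zero]
  rintro ⟨f⟩
  exact hH (hG.comap f.toHom f.injective)

theorem nC4_eq_zero_of_isAcyclic (hG : G.IsAcyclic) : nC4 G = 0 := by
  have hcycle : ¬ (SimpleGraph.cycleGraph 4).IsAcyclic := by
    have hadj : ∀ i, (SimpleGraph.cycleGraph 4).Adj i (i + 1) := by decide
    exact fun h => h (.cons (hadj 0) (.cons (hadj 1) (.cons (hadj 2) (.cons (hadj 3) .nil))))
      (by simp [SimpleGraph.Walk.isCycle_def, SimpleGraph.Walk.isTrail_def])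
  rw [nC4, copyCount_eq_zero_of_isAcyclic hG hcycle, Nat.cast_zero]

theorem nPaw_eq_zero_of_isAcyclic (hG : G.IsAcyclic) : nPaw G = 0 := by
  have hpaw : ¬ pawGraph.IsAcyclic := by
    rw [pawGraph_eq]
    exact not_isAcyclic_of_triangle (x := 0) (y := 1) (z := 2) (by decide) (by decide) (by decide)
  rw [nPaw, copyCount_eq_zero_of_isAcyclic hG hpaw, Nat.cast_zero]

theorem nC3L2_eq_zero_of_isAcyclic (hG : G.IsAcyclic) : nC3L2 G = 0 := by
  rw [nC3L2, copyCount_congr triangleSumEdgeIso, copyCount_eq_zero_of_isAcyclic hG, Nat.cast_zero]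
  exact not_isAcyclic_of_triangle (x := 0) (y := 1) (z := 2) (by decide) (by decide) (by decide)

end Forests

section Pairs

variable {V : Type*} [DecidableEq V]

theorem card_vertices_inter_le_one {p r : Finset (Sym2 V)}
    (h : typeOf p r = t00 ∨ typeOf p r = t01) : (vertices p ∩ vertices r).card ≤ 1 := by
  unfold typeOf at h
  split at h <;> first | omega | (split_ifs at h <;> simp at h) | simp at h

theorem exists_perm_mapEdges_eq {ω : PairType} {p r p' r' : Finset (Sym2 V)}
    (h : IsPattern ω p r) (h' : IsPattern ω p' r') :
    ∃ σ : Equiv.Perm V, mapEdges σ p = p' ∧ mapEdges σ r = r' := by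
  obtain ⟨f, hf, rfl, rfl⟩ := h
  obtain ⟨g, hg, rfl, rfl⟩ := h'
  obtain ⟨σ, hσ⟩ := (Equiv.Perm.isMultiplyPretransitive V (patSize ω)).exists_smul_eq
    ⟨f, hf⟩ ⟨g, hg⟩
  have hσf : σ ∘ f = g := funext fun i => DFunLike.congr_fun hσ i
  exact ⟨σ, by rw [mapEdges_mapEdges, hσf], by rw [mapEdges_mapEdges, hσf]⟩

variable [Fintype V] {G : SimpleGraph V} [DecidableRel G.Adj]

theorem pair_mem_indepPairs_iff_not_exists_common {e f : Sym2 V} :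
    ({e, f} : Finset (Sym2 V)) ∈ indepPairs G ↔
      e ∈ G.edgeSet ∧ f ∈ G.edgeSet ∧ ¬ ∃ v, v ∈ e ∧ v ∈ f := by
  induction e with | _ s t
  induction f with | _ u v
  simp only [pair_mem_indepPairs, SimpleGraph.mem_edgeSet, Sym2.mem_iff]
  refine and_congr_right fun hst => and_congr_right fun huv => ?_
  have := hst.ne
  have := huv.ne
  simp
  grind

theorem sum_sym2_indepPairs (g : Finset (Sym2 V) → ℝ) :
    ∑ z ∈ G.edgeFinset.sym2 with z.toFinset ∈ indepPairs G, g z.toFinset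
      = ∑ p ∈ indepPairs G, g p := by
  refine Finset.sum_nbij Sym2.toFinset (fun z hz => (Finset.mem_filter.1 hz).2)
    (fun z _ z' _ hzz' => Sym2.ext fun e => ?_) (fun p hp => ?_) fun _ _ => rfl
  · rw [← Sym2.mem_toFinset, hzz', Sym2.mem_toFinset]
  · obtain ⟨s, t, u, v, rfl⟩ := exists_eq_pair (Finset.mem_coe.1 hp)
    have hedges := pair_mem_indepPairs.1 hp
    have hpair : (s(s(s, t), s(u, v))).toFinset = {s(s, t), s(u, v)} := by ext; simp
    exact ⟨s(s(s, t), s(u, v)), by simp [hpair, Finset.mem_coe.1 hp, hedges.1, hedges.2.1], hpair⟩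

theorem sum_indepPairs_typeOf (E : PairType → ℝ) :
    ∑ p ∈ indepPairs G, ∑ r ∈ indepPairs G, E (typeOf p r) = ∑ ω, freq G ω * E ω := by
  rw [← Finset.sum_product' (f := fun p r => E (typeOf p r)),
    ← Finset.sum_fiberwise (g := fun x : Finset (Sym2 V) × Finset (Sym2 V) => typeOf x.1 x.2)]
  refine Finset.sum_congr rfl fun ω _ => ?_
  rw [Finset.sum_congr rfl fun x hx => congrArg E (Finset.mem_filter.1 hx).2, Finset.sum_const,
    nsmul_eq_mul, freq]

theorem sum_freq_mul_eq_varianceExpr (E : PairType → ℝ) : ∑ ω, freq G ω * E ω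
    = varianceExpr G E + freq G t00 * E t00 + freq G t01 * E t01 := by
  have huniv : (Finset.univ : Finset PairType) = {t00, t24, t13, t12, t04, t03, t021, t022, t01} :=
    rfl
  have hsum : ∑ ω, freq G ω * E ω = freq G t00 * E t00 + (freq G t24 * E t24 + (freq G t13 * E t13
      + (freq G t12 * E t12 + (freq G t04 * E t04 + (freq G t03 * E t03 + (freq G t021 * E t021
      + (freq G t022 * E t022 + freq G t01 * E t01))))))) := by
    simp [huniv]
  rw [hsum, freq_t24, freq_t13, freq_t12, freq_t04, freq_t03, freq_t021, freq_t022, varianceExpr]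
  ring

theorem varianceExpr_eq_varianceExprForest (hG : G.IsAcyclic) (E : PairType → ℝ) :
    varianceExpr G E = varianceExprForest G E := by
  rw [varianceExpr, varianceExprForest, nC4_eq_zero_of_isAcyclic hG,
    nPaw_eq_zero_of_isAcyclic hG, nC3L2_eq_zero_of_isAcyclic hG]
  ring

theorem exists_perm_of_typeOf_eq {p r p' r' : Finset (Sym2 V)}
    (hp : p ∈ indepPairs (⊤ : SimpleGraph V)) (hr : r ∈ indepPairs (⊤ : SimpleGraph V))
    (hp' : p' ∈ indepPairs (⊤ : SimpleGraph V)) (hr' : r' ∈ indepPairs (⊤ : SimpleGraph V))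
    (h : typeOf p r = typeOf p' r') : ∃ σ : Equiv.Perm V,
      (mapEdges σ p = p' ∧ mapEdges σ r = r') ∨ (mapEdges σ p = r' ∧ mapEdges σ r = p') := by
  rcases isPattern_typeOf hp hr with hpr | hrp <;>
    rcases h ▸ isPattern_typeOf hp' hr' with hpr' | hrp'
  · exact (exists_perm_mapEdges_eq hpr hpr').imp fun _ => .inl
  · exact (exists_perm_mapEdges_eq hpr hrp').imp fun _ => .inr
  · exact (exists_perm_mapEdges_eq hrp hpr').imp fun _ => .inr ∘ And.symm
  · exact (exists_perm_mapEdges_eq hrp hrp').imp fun _ => .inl ∘ And.symm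

end Pairs

section Glue

variable {V S : Type*} [DecidableEq V] [MeasurableSpace S] {s : Finset V}

/-- The function that agrees with the first component on `s` and with the second one elsewhere.
The arrangement of the vertices of `s` can thus be integrated out with the other ones fixed. -/
def glue (s : Finset V) : ({v // v ∈ s} → S) × ({v // v ∉ s} → S) ≃ᵐ (V → S) :=
  (MeasurableEquiv.piEquivPiSubtypeProd (fun _ => S) (· ∈ s)).symm

theorem glue_of_mem (x : ({v // v ∈ s} → S) × ({v // v ∉ s} → S)) {v : V} (hv : v ∈ s) :
    glue s x v = x.1 ⟨v, hv⟩ :=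
  dif_pos hv

theorem glue_of_notMem (x : ({v // v ∈ s} → S) × ({v // v ∉ s} → S)) {v : V} (hv : v ∉ s) :
    glue s x v = x.2 ⟨v, hv⟩ :=
  dif_neg hv

variable [Fintype V] {ν : Measure S} [IsProbabilityMeasure ν] {F H : (V → S) → ℝ}

theorem measurePreserving_glue : MeasurePreserving (glue s)
    ((Measure.pi fun _ => ν).prod (Measure.pi fun _ => ν)) (Measure.pi fun _ : V => ν) := by
  convert! (measurePreserving_piEquivPiSubtypeProd (fun _ : V => ν) (· ∈ s)).symm

theorem integral_eq_integral_integral_glue (hF : Integrable F (Measure.pi fun _ => ν)) :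
    ∫ π, F π ∂Measure.pi (fun _ => ν)
      = ∫ b, ∫ a, F (glue s (a, b)) ∂Measure.pi (fun _ => ν) ∂Measure.pi (fun _ => ν) := by
  rw [← measurePreserving_glue.integral_comp' (f := glue s), integral_prod_symm]
  exact (measurePreserving_glue.integrable_comp_emb (glue s).measurableEmbedding).2 hF

theorem integral_mul_of_integral_glue_const (hF : Integrable F (Measure.pi fun _ => ν))
    (hH : Integrable H (Measure.pi fun _ => ν))
    (hFH : Integrable (fun π => F π * H π) (Measure.pi fun _ => ν))
    (hconst : ∀ b b', ∫ a, F (glue s (a, b)) ∂Measure.pi (fun _ => ν)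
      = ∫ a, F (glue s (a, b')) ∂Measure.pi (fun _ => ν))
    (hdep : DependsOn H (s : Set V)ᶜ) :
    ∫ π, F π * H π ∂Measure.pi (fun _ => ν)
      = (∫ π, F π ∂Measure.pi (fun _ => ν)) * ∫ π, H π ∂Measure.pi (fun _ => ν) := by
  have hF_eq (b) : ∫ a, F (glue s (a, b)) ∂Measure.pi (fun _ => ν)
      = ∫ π, F π ∂Measure.pi (fun _ => ν) := by
    rw [integral_eq_integral_integral_glue hF, integral_congr_ae (.of_forall fun b' => hconst b' b)]
    simp
  obtain ⟨a₀⟩ : Nonempty ({v // v ∈ s} → S) :=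
    (Measure.pi fun _ : {v // v ∈ s} => ν).nonempty_of_neZero
  have hH_eq (a b) : H (glue s (a, b)) = H (glue s (a₀, b)) := hdep fun v hv => by
    rw [glue_of_notMem _ hv, glue_of_notMem _ hv]
  rw [integral_eq_integral_integral_glue (s := s) hFH,
    integral_eq_integral_integral_glue (s := s) hH]
  simp only [hH_eq, integral_mul_const, hF_eq, integral_const_mul, integral_const, probReal_univ,
    one_smul]

end Glue

namespace RandomLayout

variable {V S : Type*} [MeasurableSpace S] (L : RandomLayout V S)

section Basic

variable [DecidableEq V]

theorem α_mapEdges {σ : V → V} (hσ : Function.Injective σ)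
    (p : Finset (Sym2 V)) (π : V → S) : L.α (mapEdges σ p) π = L.α p (π ∘ σ) := by
  have hcross : (∃ e ∈ mapEdges σ p, ∃ f ∈ mapEdges σ p, e ≠ f ∧ L.cr π e f ≠ 0) ↔
      ∃ e ∈ p, ∃ f ∈ p, e ≠ f ∧ L.cr (π ∘ σ) e f ≠ 0 := by
    simp only [mapEdges, Finset.exists_mem_image, ne_eq, (Sym2.map.injective hσ).eq_iff, cr,
      Sym2.map_map]
  simp only [α, hcross]

theorem α_comp_left {g : S → S}
    (hg : ∀ a b : Sym2 S, L.crossings (a.map g) (b.map g) = L.crossings a b)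
    (p : Finset (Sym2 V)) (π : V → S) : L.α p (g ∘ π) = L.α p π := by
  have hcr (e f : Sym2 V) : L.cr (g ∘ π) e f = L.cr π e f := by
    rw [cr, cr, ← Sym2.map_map, ← Sym2.map_map, hg]
  simp only [α, hcr]

theorem dependsOn_α (p : Finset (Sym2 V)) : DependsOn (L.α p) (vertices p) := by
  intro π π' h
  have hmap (e) (he : e ∈ p) : e.map π = e.map π' := Sym2.map_congr fun v hv =>
    h v (Finset.mem_biUnion.2 ⟨e, he, Sym2.mem_toFinset.2 hv⟩)
  have hcross : (∃ e ∈ p, ∃ f ∈ p, e ≠ f ∧ L.cr π e f ≠ 0) ↔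
      ∃ e ∈ p, ∃ f ∈ p, e ≠ f ∧ L.cr π' e f ≠ 0 := by
    refine exists_congr fun e => and_congr_right fun he => exists_congr fun f =>
      and_congr_right fun hf => ?_
    rw [cr, cr, hmap e he, hmap f hf]
  simp only [α, hcross]

theorem α_pair {e f : Sym2 V} (h : e ≠ f) (π : V → S) :
    L.α {e, f} π = if L.cr π e f ≠ 0 then 1 else 0 := by
  have hcomm : L.cr π f e = L.cr π e f := L.crossings_comm _ _
  simp [α, h, h.symm, hcomm]

theorem measurable_α (p : Finset (Sym2 V)) : Measurable (L.α p) := by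
  refine Measurable.ite ?_ measurable_const measurable_const
  have hset : {π : V → S | ∃ e ∈ p, ∃ f ∈ p, e ≠ f ∧ L.cr π e f ≠ 0}
      = ⋃ e ∈ p, ⋃ f ∈ p, {π | e ≠ f ∧ L.cr π e f ≠ 0} := by
    ext π; simp only [Set.mem_ofPred_eq, Set.mem_iUnion, exists_prop]
  rw [hset]
  refine Finset.measurableSet_biUnion _ fun e _ => Finset.measurableSet_biUnion _ fun f _ => ?_
  exact (MeasurableSet.const _).inter
    (measurableSet_preimage (L.measurable_crossings e f) (MeasurableSet.singleton 0)).compl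

theorem α_mul_self (p : Finset (Sym2 V)) (π : V → S) : L.α p π * L.α p π = L.α p π := by
  unfold α; split_ifs <;> simp

theorem norm_α_le (p : Finset (Sym2 V)) (π : V → S) : ‖L.α p π‖ ≤ 1 := by
  unfold α; split_ifs <;> simp

theorem integrable_α (p : Finset (Sym2 V)) : Integrable (L.α p) L.law :=
  have := L.isProbabilityMeasure
  .of_bound (L.measurable_α p).aestronglyMeasurable 1 (.of_forall fun π => L.norm_α_le p π)

theorem integrable_α_sub (p : Finset (Sym2 V)) (δ : ℝ) :
    Integrable (fun π => L.α p π - δ) L.law :=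
  have := L.isProbabilityMeasure
  (L.integrable_α p).sub (integrable_const δ)

theorem integral_α_sub (p : Finset (Sym2 V)) (δ : ℝ) :
    ∫ π, (L.α p π - δ) ∂L.law = ∫ π, L.α p π ∂L.law - δ := by
  have := L.isProbabilityMeasure
  simp [integral_sub (L.integrable_α p) (integrable_const δ)]

theorem integrable_α_sub_mul (p r : Finset (Sym2 V)) (δ : ℝ) :
    Integrable (fun π => (L.α p π - δ) * (L.α r π - δ)) L.law :=
  (L.integrable_α_sub r δ).bdd_mul (c := 1 + ‖δ‖) (L.integrable_α_sub p δ).aestronglyMeasurable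
    (.of_forall fun π => (norm_sub_le _ _).trans (by gcongr; exact L.norm_α_le p π))

theorem integral_α_sub_mul_eq {p r : Finset (Sym2 V)} {δ : ℝ} (hp : ∫ π, L.α p π ∂L.law = δ)
    (hr : ∫ π, L.α r π ∂L.law = δ) :
    ∫ π, (L.α p π - δ) * (L.α r π - δ) ∂L.law = ∫ π, L.α p π * L.α r π ∂L.law - δ ^ 2 := by
  have hmul : Integrable (fun π => L.α p π * L.α r π) L.law := by
    simpa using L.integrable_α_sub_mul p r 0
  calc ∫ π, (L.α p π - δ) * (L.α r π - δ) ∂L.law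
      = ∫ π, (L.α p π * L.α r π - (δ * L.α r π + δ * (L.α p π - δ))) ∂L.law := by
        refine integral_congr_ae (.of_forall fun π => ?_)
        ring
    _ = ∫ π, L.α p π * L.α r π ∂L.law - (δ * δ + δ * (δ - δ)) := by
        have hlin : Integrable (fun π => δ * L.α r π + δ * (L.α p π - δ)) L.law :=
          ((L.integrable_α r).const_mul δ).add ((L.integrable_α_sub p δ).const_mul δ)
        rw [integral_sub hmul hlin, integral_add ((L.integrable_α r).const_mul δ)
          ((L.integrable_α_sub p δ).const_mul δ), integral_const_mul, integral_const_mul,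
          integral_α_sub, hp, hr]
    _ = ∫ π, L.α p π * L.α r π ∂L.law - δ ^ 2 := by ring

end Basic

section Variance

variable [Fintype V] [DecidableEq V] {L}

theorem HasConstants.integral_α_mul_α {δ : ℝ} {E : PairType → ℝ} (hc : L.HasConstants δ E)
    {p r : Finset (Sym2 V)} (hp : p ∈ indepPairs (⊤ : SimpleGraph V))
    (hr : r ∈ indepPairs (⊤ : SimpleGraph V)) :
    ∫ π, L.α p π * L.α r π ∂L.law = E (typeOf p r) + δ ^ 2 := by
  rw [← hc.expect_eq p hp r hr, L.integral_α_sub_mul_eq (hc.prob_eq p hp) (hc.prob_eq r hr),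
    sub_add_cancel]

theorem HasConstants.t24_eq {δ : ℝ} {E : PairType → ℝ} (hc : L.HasConstants δ E)
    {p : Finset (Sym2 V)} (hp : p ∈ indepPairs (⊤ : SimpleGraph V)) : E t24 = δ - δ ^ 2 := by
  have hself := hc.integral_α_mul_α hp hp
  simp only [α_mul_self] at hself
  rw [hc.prob_eq p hp, typeOf_self hp] at hself
  linarith

theorem cr_eq_ite_α {G : SimpleGraph V} [DecidableRel G.Adj] {π : V → S}
    (hself : ∀ e : Sym2 V, ¬ e.IsDiag → L.cr π e e = 0)
    (honce : ∀ e f : Sym2 V, ¬ e.IsDiag → ¬ f.IsDiag → L.cr π e f ≤ 1)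
    (hinc : ∀ e f : Sym2 V, ¬ e.IsDiag → ¬ f.IsDiag → e ≠ f → (∃ v, v ∈ e ∧ v ∈ f) →
      L.cr π e f = 0) {e f : Sym2 V} (he : e ∈ G.edgeSet) (hf : f ∈ G.edgeSet) :
    (L.cr π e f : ℝ) = if {e, f} ∈ indepPairs G then L.α {e, f} π else 0 := by
  have he' := G.not_isDiag_of_mem_edgeSet he
  have hf' := G.not_isDiag_of_mem_edgeSet hf
  simp only [pair_mem_indepPairs_iff_not_exists_common, he, hf, true_and]
  by_cases hcommon : ∃ v, v ∈ e ∧ v ∈ f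
  · rw [if_neg (not_not.2 hcommon), Nat.cast_eq_zero]
    obtain rfl | hne := eq_or_ne e f
    · exact hself e he'
    · exact hinc e f he' hf' hne hcommon
  · have hne : e ≠ f := by
      rintro rfl
      exact hcommon ⟨_, e.out_fst_mem, e.out_fst_mem⟩
    rw [if_pos hcommon, L.α_pair hne]
    have := honce e f he' hf'
    interval_cases L.cr π e f <;> simp

variable (G : SimpleGraph V) [DecidableRel G.Adj]

theorem IsGood.C_ae_eq (h : L.IsGood) :
    (fun π => (L.C G π : ℝ)) =ᵐ[L.law] fun π => ∑ p ∈ indepPairs G, L.α p π := by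
  filter_upwards [h.no_self, h.once, h.incident] with π hself honce hinc
  rw [C, Nat.cast_sum, ← sum_sym2_indepPairs, Finset.sum_filter]
  refine Finset.sum_congr rfl fun z hz => ?_
  induction z with | _ e f
  have hpair : (s(e, f)).toFinset = {e, f} := by ext; simp
  rw [Finset.mk_mem_sym2_iff, SimpleGraph.mem_edgeFinset, SimpleGraph.mem_edgeFinset] at hz
  rw [Sym2.lift_mk, hpair]
  exact cr_eq_ite_α hself honce hinc hz.1 hz.2

theorem IsGood.variance_C (h : L.IsGood) {δ : ℝ} {E : PairType → ℝ} (hc : L.HasConstants δ E) :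
    variance (fun π => (L.C G π : ℝ)) L.law
      = varianceExpr G E + freq G t00 * E t00 + freq G t01 * E t01 := by
  have := L.isProbabilityMeasure
  have htop (p) (hp : p ∈ indepPairs G) : p ∈ indepPairs (⊤ : SimpleGraph V) :=
    (mem_indepPairs_iff_subset.1 hp).1
  rw [variance_congr (h.C_ae_eq G), ← sum_freq_mul_eq_varianceExpr, ← sum_indepPairs_typeOf,
    variance_eq_integral (Finset.measurable_sum _ fun p _ => L.measurable_α p).aemeasurable,
    integral_finsetSum _ fun p _ => L.integrable_α p,
    Finset.sum_congr rfl fun p hp => hc.prob_eq p (htop p hp)]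
  simp only [← Finset.sum_sub_distrib, sq, Finset.sum_mul_sum]
  rw [integral_finsetSum _ fun p _ => integrable_finsetSum _ fun r _ =>
    L.integrable_α_sub_mul p r δ]
  refine Finset.sum_congr rfl fun p hp => ?_
  rw [integral_finsetSum _ fun r _ => L.integrable_α_sub_mul p r δ]
  exact Finset.sum_congr rfl fun r hr => hc.expect_eq p (htop p hp) r (htop r hr)

theorem IsGood.variance_C_eq_varianceExpr (h : L.IsGood) {δ : ℝ} {E : PairType → ℝ}
    (hc : L.HasConstants δ E) (h00 : E t00 = 0) (h01 : E t01 = 0) :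
    variance (fun π => (L.C G π : ℝ)) L.law = varianceExpr G E := by
  rw [h.variance_C G hc, h00, h01]
  ring

end Variance

section Exchangeable

variable {L}

theorem IsExchangeable.integral_comp (h : L.IsExchangeable) (σ : Equiv.Perm V) {F : (V → S) → ℝ}
    (hF : Measurable F) : ∫ π, F (π ∘ σ) ∂L.law = ∫ π, F π ∂L.law := by
  have hσ : Measurable fun π : V → S => π ∘ σ :=
    measurable_pi_lambda _ fun _ => measurable_pi_apply _
  conv_rhs => rw [← h σ]
  rw [integral_map hσ.aemeasurable hF.aestronglyMeasurable]

theorem IsHomogeneous.isExchangeable [Fintype V] (h : L.IsHomogeneous) : L.IsExchangeable := by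
  obtain ⟨ν, hν, hlaw, -⟩ := h
  intro σ
  rw [hlaw]
  have hmap := (measurePreserving_piCongrLeft (fun _ : V => ν) σ.symm).map_eq
  convert! hmap using 2
  ext π v
  have happly := Equiv.piCongrLeft_apply_apply (fun _ : V => S) σ.symm π (σ v)
  rw [Equiv.symm_apply_apply] at happly
  exact happly.symm

variable [Fintype V] [DecidableEq V]

theorem IsExchangeable.integral_eq_of_typeOf_eq (h : L.IsExchangeable)
    {p r p' r' : Finset (Sym2 V)}
    (hp : p ∈ indepPairs (⊤ : SimpleGraph V)) (hr : r ∈ indepPairs (⊤ : SimpleGraph V))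
    (hp' : p' ∈ indepPairs (⊤ : SimpleGraph V)) (hr' : r' ∈ indepPairs (⊤ : SimpleGraph V))
    (ht : typeOf p r = typeOf p' r') (δ : ℝ) :
    ∫ π, (L.α p π - δ) * (L.α r π - δ) ∂L.law
      = ∫ π, (L.α p' π - δ) * (L.α r' π - δ) ∂L.law := by
  have hmeas : Measurable fun π => (L.α p π - δ) * (L.α r π - δ) :=
    ((L.measurable_α p).sub_const δ).mul ((L.measurable_α r).sub_const δ)
  obtain ⟨σ, hσ⟩ := exists_perm_of_typeOf_eq hp hr hp' hr' ht
  rw [← h.integral_comp σ hmeas]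
  simp only [← L.α_mapEdges σ.injective]
  obtain ⟨rfl, rfl⟩ | ⟨rfl, rfl⟩ := hσ
  · rfl
  · exact integral_congr_ae (.of_forall fun _ => mul_comm _ _)

theorem IsExchangeable.exists_integral_α_eq (h : L.IsExchangeable) :
    ∃ δ : ℝ, ∀ p ∈ indepPairs (⊤ : SimpleGraph V), ∫ π, L.α p π ∂L.law = δ := by
  rcases (indepPairs (⊤ : SimpleGraph V)).eq_empty_or_nonempty with hempty | ⟨p₀, hp₀⟩
  · exact ⟨0, by simp [hempty]⟩
  · refine ⟨∫ π, L.α p₀ π ∂L.law, fun p hp => ?_⟩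
    have hself := h.integral_eq_of_typeOf_eq hp hp hp₀ hp₀
      ((typeOf_self hp).trans (typeOf_self hp₀).symm) 0
    simpa only [sub_zero, α_mul_self] using hself

theorem IsExchangeable.exists_hasConstants (h : L.IsExchangeable) :
    ∃ (δ : ℝ) (E : PairType → ℝ), L.HasConstants δ E := by
  obtain ⟨δ, hδ⟩ := h.exists_integral_α_eq
  let Q := {p : Finset (Sym2 V) // p ∈ indepPairs (⊤ : SimpleGraph V)}
  obtain ⟨E, hE⟩ := (Function.factorsThrough_iff (f := fun x : Q × Q => typeOf x.1.1 x.2.1)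
    fun x => ∫ π, (L.α x.1.1 π - δ) * (L.α x.2.1 π - δ) ∂L.law).1 fun x y hxy =>
      h.integral_eq_of_typeOf_eq x.1.2 x.2.2 y.1.2 y.2.2 hxy δ
  exact ⟨δ, E, hδ, fun p hp r hr => congrFun hE (⟨p, hp⟩, ⟨r, hr⟩)⟩

end Exchangeable

section Homogeneous

variable [DecidableEq V] {L}

/- A symmetry `g` of the layout that takes the position `b x` to `b' x` preserves `α p` when it is
applied to all the vertices of `p`, and the law of the positions of those other than `x`. -/
theorem integral_α_glue_eq {ν : Measure S} [IsProbabilityMeasure ν]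
    (hν : ∀ x y : S, ∃ g : S → S, MeasurePreserving g ν ν ∧ g x = y ∧
      ∀ a b : Sym2 S, L.crossings (a.map g) (b.map g) = L.crossings a b)
    (p : Finset (Sym2 V)) (x : V) (b b' : {v // v ∉ (vertices p).erase x} → S) :
    ∫ a, L.α p (glue ((vertices p).erase x) (a, b)) ∂Measure.pi (fun _ => ν)
      = ∫ a, L.α p (glue ((vertices p).erase x) (a, b')) ∂Measure.pi (fun _ => ν) := by
  have hx : x ∉ (vertices p).erase x := Finset.notMem_erase x _
  obtain ⟨g, hgν, hgx, hgc⟩ := hν (b ⟨x, hx⟩) (b' ⟨x, hx⟩)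
  have hα (a) : L.α p (glue _ (a, b)) = L.α p (glue _ (g ∘ a, b')) := by
    rw [← L.α_comp_left hgc]
    refine L.dependsOn_α p fun v hv => ?_
    obtain rfl | hvx := eq_or_ne v x
    · simp only [Function.comp, glue_of_notMem _ hx, hgx]
    · simp only [Function.comp, glue_of_mem _ (Finset.mem_erase.2 ⟨hvx, hv⟩)]
  have hg : MeasurePreserving (fun a : {v // v ∈ (vertices p).erase x} → S => g ∘ a)
      (Measure.pi fun _ => ν) (Measure.pi fun _ => ν) :=
    measurePreserving_pi (fun _ => ν) (fun _ => ν) fun _ => hgν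
  have hmeas : Measurable fun a => L.α p (glue ((vertices p).erase x) (a, b')) :=
    (L.measurable_α p).comp ((glue _).measurable.comp (measurable_id.prodMk measurable_const))
  simp only [hα]
  conv_rhs => rw [← hg.map_eq]
  rw [integral_map hg.aemeasurable hmeas.aestronglyMeasurable]

variable [Fintype V]

theorem IsHomogeneous.integral_α_sub_mul_eq_zero (h : L.IsHomogeneous) {p r : Finset (Sym2 V)}
    {x : V} (hx : vertices p ∩ vertices r ⊆ {x}) {δ : ℝ} (hδ : ∫ π, L.α p π ∂L.law = δ) :
    ∫ π, (L.α p π - δ) * (L.α r π - δ) ∂L.law = 0 := by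
  have hp := L.integrable_α_sub p δ
  have hr := L.integrable_α_sub r δ
  have hpr := L.integrable_α_sub_mul p r δ
  have hzero : ∫ π, (L.α p π - δ) ∂L.law = 0 := by rw [integral_α_sub, hδ, sub_self]
  obtain ⟨ν, hν, hlaw, hhom⟩ := h
  rw [hlaw] at hp hr hpr hzero ⊢
  rw [integral_mul_of_integral_glue_const (s := (vertices p).erase x) hp hr hpr, hzero, zero_mul]
  · intro b b'
    have hint (b) : Integrable (fun a => L.α p (glue ((vertices p).erase x) (a, b)))
        (Measure.pi fun _ => ν) :=
      .of_bound ((L.measurable_α p).comp ((glue _).measurable.comp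
        (measurable_id.prodMk measurable_const))).aestronglyMeasurable 1
        (.of_forall fun _ => L.norm_α_le p _)
    rw [integral_sub (hint b) (integrable_const δ), integral_sub (hint b') (integrable_const δ),
      integral_α_glue_eq hhom p x b b']
  · intro π π' hπ
    have hα : L.α r π = L.α r π' := L.dependsOn_α r fun v hv => hπ v <| by
      simp only [Finset.coe_erase, Set.mem_compl_iff, Set.mem_sdiff, Finset.mem_coe,
        Set.mem_singleton_iff, not_and, not_not]
      exact fun hvp => Finset.mem_singleton.1 (hx (Finset.mem_inter.2 ⟨hvp, hv⟩))
    simp only [hα]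

theorem IsHomogeneous.exists_hasConstants (h : L.IsHomogeneous) :
    ∃ (δ : ℝ) (E : PairType → ℝ), L.HasConstants δ E ∧ E t00 = 0 ∧ E t01 = 0 := by
  obtain ⟨δ, E, hE⟩ := h.isExchangeable.exists_hasConstants
  refine ⟨δ, fun ω => if ω = t00 ∨ ω = t01 then 0 else E ω, ⟨hE.prob_eq, fun p hp r hr => ?_⟩,
    by simp, by simp⟩
  split_ifs with ht
  · obtain ⟨s, -⟩ := exists_eq_pair hp
    have : Nonempty V := ⟨s⟩
    obtain ⟨x, hx⟩ :=
      Finset.card_le_one_iff_subset_singleton.1 (card_vertices_inter_le_one ht)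
    exact h.integral_α_sub_mul_eq_zero hx (hE.prob_eq p hp)
  · exact hE.expect_eq p hp r hr

end Homogeneous

end RandomLayout

section Arcs

variable {n l : ℕ}

theorem arcCrossings_mk (x y z w : Fin n) : arcCrossings s(x, y) s(z, w) =
    if (x ⊓ y < z ⊓ w ∧ z ⊓ w < x ⊔ y ∧ x ⊔ y < z ⊔ w) ∨
      (z ⊓ w < x ⊓ y ∧ x ⊓ y < z ⊔ w ∧ z ⊔ w < x ⊔ y) then 1 else 0 :=
  rfl

theorem arcCrossings_self (a : Sym2 (Fin n)) : arcCrossings a a = 0 := by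
  simp [arcCrossings]

theorem arcCrossings_le_one (a b : Sym2 (Fin n)) : arcCrossings a b ≤ 1 := by
  unfold arcCrossings; split_ifs <;> simp

theorem arcCrossings_of_common (x y z : Fin n) : arcCrossings s(x, y) s(x, z) = 0 := by
  rw [arcCrossings_mk, if_neg]
  grind

theorem arcCrossings_map {g : Fin l → Fin n} (hg : StrictMono g) (a b : Sym2 (Fin l)) :
    arcCrossings (a.map g) (b.map g) = arcCrossings a b := by
  induction a with | _ x y
  induction b with | _ z w
  simp only [Sym2.map_mk, arcCrossings_mk, ← hg.monotone.map_inf, ← hg.monotone.map_sup,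
    hg.lt_iff_lt]

theorem exists_strictMono_comp_perm {g : Fin l → Fin n} (hg : Function.Injective g) :
    ∃ (h : Fin l → Fin n) (τ : Equiv.Perm (Fin l)), StrictMono h ∧ g = h ∘ τ :=
  ⟨g ∘ Tuple.sort g, (Tuple.sort g).symm,
    (Tuple.monotone_sort g).strictMono_of_injective (hg.comp (Tuple.sort g).injective), by
    ext i; simp⟩

theorem arcCrossings_matchings_perm : ∀ τ : Equiv.Perm (Fin 4),
    arcCrossings s(τ 0, τ 1) s(τ 2, τ 3) + arcCrossings s(τ 0, τ 2) s(τ 1, τ 3)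
      + arcCrossings s(τ 0, τ 3) s(τ 1, τ 2) = 1 := by
  decide +kernel

theorem arcCrossings_matchings {x y z w : Fin n} (h : [x, y, z, w].Nodup) :
    arcCrossings s(x, y) s(z, w) + arcCrossings s(x, z) s(y, w)
      + arcCrossings s(x, w) s(y, z) = 1 := by
  have hinj : Function.Injective ![x, y, z, w] := List.nodup_ofFn.1 (by
    simpa [List.ofFn_succ] using h)
  obtain ⟨g, τ, hg, heq⟩ := exists_strictMono_comp_perm hinj
  have hx : x = g (τ 0) := congrFun heq 0
  have hy : y = g (τ 1) := congrFun heq 1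
  have hz : z = g (τ 2) := congrFun heq 2
  have hw : w = g (τ 3) := congrFun heq 3
  rw [hx, hy, hz, hw]
  simp only [← Sym2.map_mk, arcCrossings_map hg]
  exact arcCrossings_matchings_perm τ

theorem sum_perm_arcCrossings {g : Fin l → Fin n} (hg : Function.Injective g)
    (s t u v s' t' u' v' : Fin l) :
    ∑ σ : Equiv.Perm (Fin l), arcCrossings s(g (σ s), g (σ t)) s(g (σ u), g (σ v)) *
        arcCrossings s(g (σ s'), g (σ t')) s(g (σ u'), g (σ v'))
      = ∑ σ : Equiv.Perm (Fin l), arcCrossings s(σ s, σ t) s(σ u, σ v) *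
        arcCrossings s(σ s', σ t') s(σ u', σ v') := by
  obtain ⟨h, τ, hh, rfl⟩ := exists_strictMono_comp_perm hg
  refine Fintype.sum_equiv (Equiv.mulLeft τ) _ _ fun σ => ?_
  simp only [Function.comp, ← Sym2.map_mk, arcCrossings_map hh]
  rfl

theorem sum_perm_five_arcCrossings : ∑ σ : Equiv.Perm (Fin 5),
    arcCrossings s(σ 0, σ 1) s(σ 2, σ 3) * arcCrossings s(σ 0, σ 1) s(σ 2, σ 4) = 20 := by
  decide +kernel

theorem sum_perm_six_arcCrossings : ∑ σ : Equiv.Perm (Fin 6),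
    arcCrossings s(σ 0, σ 1) s(σ 2, σ 3) * arcCrossings s(σ 0, σ 1) s(σ 4, σ 5) = 96 := by
  decide +kernel

end Arcs

section RandomLinearArrangement

theorem map_equiv_uniformOn {Ω : Type*} [MeasurableSpace Ω] [DiscreteMeasurableSpace Ω]
    (T : Ω ≃ Ω) {s : Set Ω} (hs : T ⁻¹' s = s) : (uniformOn s).map T = uniformOn s := by
  ext t ht
  rw [Measure.map_apply Measurable.of_discrete ht, uniformOn, cond_apply .of_discrete,
    cond_apply .of_discrete]
  congr 1
  conv_lhs => rw [← hs]
  rw [← Set.preimage_inter, ← Equiv.image_symm_eq_preimage,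
    Measure.count_injective_image T.symm.injective]

variable {V : Type*} [Fintype V]

theorem rla_isGood : (rla V).IsGood where
  no_self := .of_forall fun _ _ _ => arcCrossings_self _
  once := .of_forall fun _ _ _ _ _ => arcCrossings_le_one _ _
  incident := .of_forall fun π e f _ _ _ h => by
    obtain ⟨v, hve, hvf⟩ := h
    obtain ⟨x, rfl⟩ := Sym2.mem_iff_exists.1 hve
    obtain ⟨y, rfl⟩ := Sym2.mem_iff_exists.1 hvf
    exact arcCrossings_of_common _ _ _

theorem rla_isExchangeable : (rla V).IsExchangeable := fun σ =>
  map_equiv_uniformOn (σ.symm.arrowCongr (Equiv.refl _))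
    (Set.ext fun π => σ.bijective.of_comp_iff π)

theorem rla_ae_injective : ∀ᵐ π ∂(rla V).law, Function.Injective π := by
  have hmem : ∀ᵐ π ∂(rla V).law, π ∈ linearArrangements V := ae_cond_mem .of_discrete
  filter_upwards [hmem] with π hπ using hπ.injective

variable [DecidableEq V]

theorem rla_α_pair {s t u v : V} (h : [s, t, u, v].Nodup) (π : V → Fin (Fintype.card V)) :
    (rla V).α {s(s, t), s(u, v)} π = arcCrossings s(π s, π t) s(π u, π v) := by
  have hne : s(s, t) ≠ s(u, v) := by simp at h ⊢; tauto
  have hcr : (rla V).cr π s(s, t) s(u, v) = arcCrossings s(π s, π t) s(π u, π v) := rfl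
  have hle := arcCrossings_le_one s(π s, π t) s(π u, π v)
  rw [RandomLayout.α_pair _ hne, hcr]
  interval_cases arcCrossings s(π s, π t) s(π u, π v) <;> simp

theorem rla_sum_matchings_α {s t u v : V} (h : [s, t, u, v].Nodup)
    {π : V → Fin (Fintype.card V)} (hπ : Function.Injective π) :
    (rla V).α {s(s, t), s(u, v)} π + (rla V).α {s(s, u), s(t, v)} π
      + (rla V).α {s(s, v), s(t, u)} π = 1 := by
  rw [rla_α_pair h, rla_α_pair (by grind), rla_α_pair (by grind)]
  exact_mod_cast arcCrossings_matchings (h.map hπ)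

theorem rla_sum_matchings_integral_α_mul {s t u v : V} (h : [s, t, u, v].Nodup)
    {F : (V → Fin (Fintype.card V)) → ℝ} (hF : Integrable F (rla V).law) :
    ∫ π, (rla V).α {s(s, t), s(u, v)} π * F π ∂(rla V).law
      + ∫ π, (rla V).α {s(s, u), s(t, v)} π * F π ∂(rla V).law
      + ∫ π, (rla V).α {s(s, v), s(t, u)} π * F π ∂(rla V).law = ∫ π, F π ∂(rla V).law := by
  have hint (p : Finset (Sym2 V)) : Integrable (fun π => (rla V).α p π * F π) (rla V).law :=
    hF.bdd_mul ((rla V).integrable_α p).aestronglyMeasurable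
      (.of_forall fun π => (rla V).norm_α_le p π)
  have hadd : Integrable (fun π => (rla V).α {s(s, t), s(u, v)} π * F π +
    (rla V).α {s(s, u), s(t, v)} π * F π) (rla V).law := (hint _).add (hint _)
  rw [← integral_add (hint _) (hint _), ← integral_add hadd (hint _)]
  refine integral_congr_ae ?_
  filter_upwards [rla_ae_injective] with π hπ
  linear_combination F π * rla_sum_matchings_α h hπ

variable {δ : ℝ} {E : PairType → ℝ}

theorem rla_prob_eq (hc : (rla V).HasConstants δ E) {p : Finset (Sym2 V)}
    (hp : p ∈ indepPairs (⊤ : SimpleGraph V)) : δ = 1 / 3 := by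
  have := (rla V).isProbabilityMeasure
  obtain ⟨s, t, u, v, h, rfl⟩ := exists_nodup_eq_pair hp
  have hsum := rla_sum_matchings_integral_α_mul h (integrable_const 1)
  simp only [mul_one, integral_const, probReal_univ, one_smul] at hsum
  rw [hc.prob_eq _ hp, hc.prob_eq _ (pair_mem_indepPairs_top.2 (by grind)),
    hc.prob_eq _ (pair_mem_indepPairs_top.2 (by grind))] at hsum
  linarith

section Constants

variable {n : ℕ} {f : Fin n → V} {s t u v s' t' u' v' : Fin n} {ω ω₁ ω₂ ω₃ : PairType}

theorem integral_α_mapEdges_mul_α_mapEdges (hc : (rla V).HasConstants δ E)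
    (hf : Function.Injective f) {P R : Finset (Sym2 (Fin n))}
    (hP : P ∈ indepPairs (⊤ : SimpleGraph (Fin n)))
    (hR : R ∈ indepPairs (⊤ : SimpleGraph (Fin n))) :
    ∫ π, (rla V).α (mapEdges f P) π * (rla V).α (mapEdges f R) π ∂(rla V).law
      = E (typeOf P R) + δ ^ 2 := by
  rw [hc.integral_α_mul_α (mapEdges_mem_indepPairs_top hf hP) (mapEdges_mem_indepPairs_top hf hR),
    typeOf_mapEdges hf]

theorem rla_sum_matchings_constants (hc : (rla V).HasConstants (1 / 3) E)
    (hf : Function.Injective f) {R : Finset (Sym2 (Fin n))}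
    (hR : R ∈ indepPairs (⊤ : SimpleGraph (Fin n))) (h : [s, t, u, v].Nodup)
    (hω₁ : typeOf {s(s, t), s(u, v)} R = ω₁) (hω₂ : typeOf {s(s, u), s(t, v)} R = ω₂)
    (hω₃ : typeOf {s(s, v), s(t, u)} R = ω₃) :
    E ω₁ + E ω₂ + E ω₃ = 0 := by
  subst hω₁ hω₂ hω₃
  have hsum := rla_sum_matchings_integral_α_mul (h.map hf) ((rla V).integrable_α (mapEdges f R))
  simp only [← mapEdges_pair] at hsum
  rw [integral_α_mapEdges_mul_α_mapEdges hc hf (pair_mem_indepPairs_top.2 h) hR,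
    integral_α_mapEdges_mul_α_mapEdges hc hf (pair_mem_indepPairs_top.2 (by grind)) hR,
    integral_α_mapEdges_mul_α_mapEdges hc hf (pair_mem_indepPairs_top.2 (by grind)) hR,
    hc.prob_eq _ (mapEdges_mem_indepPairs_top hf hR)] at hsum
  linarith

theorem sum_perm_rla_α_mul_α (hf : Function.Injective f) (h : [s, t, u, v].Nodup)
    (h' : [s', t', u', v'].Nodup) {π : V → Fin (Fintype.card V)} (hπ : Function.Injective π) :
    ∑ σ : Equiv.Perm (Fin n), (rla V).α (mapEdges (f ∘ σ) {s(s, t), s(u, v)}) π *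
        (rla V).α (mapEdges (f ∘ σ) {s(s', t'), s(u', v')}) π
      = (∑ σ : Equiv.Perm (Fin n), arcCrossings s(σ s, σ t) s(σ u, σ v) *
        arcCrossings s(σ s', σ t') s(σ u', σ v') : ℕ) := by
  rw [← sum_perm_arcCrossings (hπ.comp hf) s t u v s' t' u' v', Nat.cast_sum]
  refine Finset.sum_congr rfl fun σ _ => ?_
  have hfσ := hf.comp σ.injective
  rw [mapEdges_pair, mapEdges_pair, rla_α_pair (h.map hfσ), rla_α_pair (h'.map hfσ), Nat.cast_mul]
  rfl

theorem factorial_mul_constants (hc : (rla V).HasConstants δ E) (hf : Function.Injective f)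
    (h : [s, t, u, v].Nodup) (h' : [s', t', u', v'].Nodup)
    (hω : typeOf {s(s, t), s(u, v)} {s(s', t'), s(u', v')} = ω) :
    n.factorial * (E ω + δ ^ 2)
      = (∑ σ : Equiv.Perm (Fin n), arcCrossings s(σ s, σ t) s(σ u, σ v) *
        arcCrossings s(σ s', σ t') s(σ u', σ v') : ℕ) := by
  have := (rla V).isProbabilityMeasure
  subst hω
  have hE (σ : Equiv.Perm (Fin n)) :
      ∫ π, (rla V).α (mapEdges (f ∘ σ) {s(s, t), s(u, v)}) π *
        (rla V).α (mapEdges (f ∘ σ) {s(s', t'), s(u', v')}) π ∂(rla V).law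
      = E (typeOf {s(s, t), s(u, v)} {s(s', t'), s(u', v')}) + δ ^ 2 :=
    integral_α_mapEdges_mul_α_mapEdges hc (hf.comp σ.injective) (pair_mem_indepPairs_top.2 h)
      (pair_mem_indepPairs_top.2 h')
  have hae := integral_congr_ae
    (rla_ae_injective.mono fun π hπ => sum_perm_rla_α_mul_α hf h h' hπ)
  rw [integral_finsetSum _ fun σ _ => .of_finite, Finset.sum_congr rfl fun σ _ => hE σ] at hae
  simpa [Fintype.card_perm, mul_add] using hae

end Constants

variable (hc : (rla V).HasConstants (1 / 3) E)
include hc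

theorem rla_t13_eq {f : Fin 5 → V} (hf : Function.Injective f) : E t13 = 1 / 18 := by
  have hcount := factorial_mul_constants hc hf (s := 0) (t := 1) (u := 2) (v := 3) (s' := 0)
    (t' := 1) (u' := 2) (v' := 4) (ω := t13) (by decide) (by decide) (by decide)
  rw [sum_perm_five_arcCrossings] at hcount
  norm_num [Nat.factorial] at hcount
  linarith

theorem rla_t12_eq {f : Fin 6 → V} (hf : Function.Injective f) : E t12 = 1 / 45 := by
  have hcount := factorial_mul_constants hc hf (s := 0) (t := 1) (u := 2) (v := 3) (s' := 0)
    (t' := 1) (u' := 4) (v' := 5) (ω := t12) (by decide) (by decide) (by decide)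
  rw [sum_perm_six_arcCrossings] at hcount
  norm_num [Nat.factorial] at hcount
  linarith

theorem rla_t021_eq {f : Fin 6 → V} (hf : Function.Injective f) : E t021 = -1 / 90 := by
  have hsum : E t12 + E t021 + E t021 = 0 := rla_sum_matchings_constants (n := 6) hc hf
    (patSnd_mem t12) (s := 0) (t := 1) (u := 2) (v := 3) (by decide) (by decide) (by decide)
    (by decide)
  linarith [rla_t12_eq hc hf]

theorem eq_rlaConstants (ω : PairType) {f : Fin (patSize ω) → V} (hf : Function.Injective f) :
    E ω = rlaConstants ω := by
  have ht24 : E t24 = 1 / 3 - (1 / 3) ^ 2 :=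
    hc.t24_eq (mapEdges_mem_indepPairs_top hf (patFst_mem ω))
  cases ω <;> rw [rlaConstants]
  case t00 =>
    have : E t00 + E t00 + E t00 = 0 := rla_sum_matchings_constants (n := 8) hc hf
      (patSnd_mem t00) (s := 0) (t := 1) (u := 2) (v := 3) (by decide) (by decide) (by decide)
      (by decide)
    linarith
  case t01 =>
    have : E t01 + E t01 + E t01 = 0 := rla_sum_matchings_constants (n := 7) hc hf
      (patSnd_mem t01) (s := 0) (t := 1) (u := 2) (v := 3) (by decide) (by decide) (by decide)
      (by decide)
    linarith
  case t04 =>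
    have : E t04 + E t24 + E t04 = 0 := rla_sum_matchings_constants (n := 4) hc hf
      (patSnd_mem t04) (s := 0) (t := 1) (u := 2) (v := 3) (by decide) (by decide) (by decide)
      (by decide)
    linarith
  case t03 =>
    have : E t03 + E t13 + E t03 = 0 := rla_sum_matchings_constants (n := 5) hc hf
      (patSnd_mem t03) (s := 0) (t := 1) (u := 2) (v := 3) (by decide) (by decide) (by decide)
      (by decide)
    linarith [rla_t13_eq hc hf]
  case t022 =>
    have : E t022 + E t021 + E t022 = 0 := rla_sum_matchings_constants (n := 6) hc hf
      (patSnd_mem t022) (s := 0) (t := 1) (u := 2) (v := 3) (by decide) (by decide) (by decide)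
      (by decide)
    linarith [rla_t021_eq hc hf]
  case t24 => linarith
  case t13 => exact rla_t13_eq hc hf
  case t12 => exact rla_t12_eq hc hf
  case t021 => exact rla_t021_eq hc hf

omit hc

theorem rla_hasConstants : (rla V).HasConstants (1 / 3) rlaConstants := by
  obtain ⟨δ, E, hc⟩ := (rla_isExchangeable (V := V)).exists_hasConstants
  refine ⟨fun p hp => (hc.prob_eq p hp).trans (rla_prob_eq hc hp), fun p hp r hr => ?_⟩
  obtain rfl := rla_prob_eq hc hp
  rw [hc.expect_eq p hp r hr]
  rcases isPattern_typeOf hp hr with ⟨f, hf, -⟩ | ⟨f, hf, -⟩ <;> exact eq_rlaConstants hc _ hf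

variable (G : SimpleGraph V) [DecidableRel G.Adj]

theorem variance_rla_C : variance (fun π => ((rla V).C G π : ℝ)) (rla V).law
    = (1 / 180) * (8 * (m G + 2) * q G + 2 * K G - (2 * m G + 7) * nL G 4 - 12 * nC4 G
      + 6 * nPaw G - nL G 5 + 6 * nC3L2 G - 3 * Lambda1 G + Lambda2 G - 2 * Phi1 G + Phi2 G) := by
  rw [rla_isGood.variance_C_eq_varianceExpr G rla_hasConstants rfl rfl]
  simp only [varianceExpr, rlaConstants]
  ring

variable {G} in
theorem variance_rla_C_of_isAcyclic (hG : G.IsAcyclic) :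
    variance (fun π => ((rla V).C G π : ℝ)) (rla V).law
      = (1 / 180) * (8 * (m G + 2) * q G + 2 * K G - (2 * m G + 7) * nL G 4
        - nL G 5 - 3 * Lambda1 G + Lambda2 G - 2 * Phi1 G + Phi2 G) := by
  rw [variance_rla_C, nC4_eq_zero_of_isAcyclic hG, nPaw_eq_zero_of_isAcyclic hG,
    nC3L2_eq_zero_of_isAcyclic hG]
  ring

end RandomLinearArrangement

end EdgeCrossing

theorem mainTheorem1 {V : Type*} [Fintype V] [DecidableEq V]
    (G : SimpleGraph V) [DecidableRel G.Adj] :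
    -- the frequencies of the types
    (freq G t24 = q G ∧
      freq G t13 = K G - 4 * q G - 2 * nL G 4 ∧
      freq G t12 = 2 * ((m G + 2) * q G + nL G 4 - K G) ∧
      freq G t04 = 2 * nC4 G ∧
      freq G t04 = (1 / 4) * (G.adjMatrix ℝ ^ 4).trace - nL G 3 - (1 / 2) * nL G 2 ∧
      freq G t04 = (1 / 4) * (G.adjMatrix ℝ ^ 4).trace + q G - (1 / 2) * m G ^ 2 ∧
      freq G t03 = Lambda1 G - 2 * nL G 4 - 8 * nC4 G - 2 * nPaw G ∧
      freq G t021 = 2 * q G + (m G + 5) * nL G 4 + 8 * nC4 G + 3 * nPaw G + Phi1 G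
        - 3 * nC3L2 G - Lambda1 G - Lambda2 G - K G ∧
      freq G t022 = 4 * q G + 5 * nL G 4 + 2 * nPaw G + 4 * nC4 G + Phi2 G
        - Lambda2 G - 2 * K G - nL G 5) ∧
    -- the cyclic subgraphs do not occur in forests
    (G.IsAcyclic → nC4 G = 0 ∧ nPaw G = 0 ∧ nC3L2 G = 0) ∧
    -- general layouts
    (∀ (S : Type*) [MeasurableSpace S] (L : RandomLayout V S), L.IsGood →
      (∀ (δ : ℝ) (E : PairType → ℝ), L.HasConstants δ E →
        ProbabilityTheory.variance (fun π => (L.C G π : ℝ)) L.law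
          = varianceExpr G E + freq G t00 * E t00 + freq G t01 * E t01 ∧
        (E t00 = 0 → E t01 = 0 →
          ProbabilityTheory.variance (fun π => (L.C G π : ℝ)) L.law = varianceExpr G E ∧
          (G.IsAcyclic →
            ProbabilityTheory.variance (fun π => (L.C G π : ℝ)) L.law
              = varianceExprForest G E))) ∧
      (L.IsExchangeable → ∃ (δ : ℝ) (E : PairType → ℝ), L.HasConstants δ E) ∧
      (L.IsHomogeneous → ∃ (δ : ℝ) (E : PairType → ℝ),
        L.HasConstants δ E ∧ E t00 = 0 ∧ E t01 = 0)) ∧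
    -- uniformly random linear arrangements
    ((rla V).IsGood ∧ (rla V).HasConstants (1 / 3) rlaConstants ∧
      ProbabilityTheory.variance (fun π => ((rla V).C G π : ℝ)) (rla V).law
        = (1 / 180) * (8 * (m G + 2) * q G + 2 * K G - (2 * m G + 7) * nL G 4 - 12 * nC4 G
            + 6 * nPaw G - nL G 5 + 6 * nC3L2 G - 3 * Lambda1 G + Lambda2 G
            - 2 * Phi1 G + Phi2 G) ∧
      (G.IsAcyclic →
        ProbabilityTheory.variance (fun π => ((rla V).C G π : ℝ)) (rla V).law
          = (1 / 180) * (8 * (m G + 2) * q G + 2 * K G - (2 * m G + 7) * nL G 4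
              - nL G 5 - 3 * Lambda1 G + Lambda2 G - 2 * Phi1 G + Phi2 G))) := by
  refine ⟨⟨freq_t24 G, freq_t13 G, freq_t12 G, freq_t04 G, freq_t04_eq_trace G,
      freq_t04_eq_trace_add_q_sub_m_sq G, freq_t03 G, freq_t021 G, freq_t022 G⟩,
    fun hG => ⟨nC4_eq_zero_of_isAcyclic hG, nPaw_eq_zero_of_isAcyclic hG,
      nC3L2_eq_zero_of_isAcyclic hG⟩,
    fun S _ L hL => ⟨fun δ E hE => ⟨hL.variance_C G hE, fun h00 h01 => ?_⟩,
      fun h => h.exists_hasConstants, fun h => h.exists_hasConstants⟩,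
    rla_isGood, rla_hasConstants, variance_rla_C G, variance_rla_C_of_isAcyclic⟩
  have hvar := hL.variance_C_eq_varianceExpr G hE h00 h01
  exact ⟨hvar, fun hG => hvar.trans (varianceExpr_eq_varianceExprForest hG E)⟩
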